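/- **Riemann's bilinear relations for holomorphic $1$-cochains.** *Setting.* Let $g\ge 1$, let $M$ be the closed oriented surface of genus $g$ obtained from a $4g$-gon with counterclockwise sides $a_1,b_1,a_1^{-1},b_1^{-1},\dots,a_g,b_g,a_g^{-1},b_g^{-1}$ by identifying $a_i$ with $a_i^{-1}$ and $b_i$ with $b_i^{-1}$, with the orientation induced by the counterclockwise one, and let $K$ be a finite simplicial complex triangulating $M$ that subdivides this cell decomposition. Each $a_i$, $b_i$ is then a sum of oriented edges of $K$ (the canonical homology basis). Let $C^j$ be the complex-valued simplicial $j$-cochains of $K$ and $\delta$ the coboundary. For $\sigma,\tau\in C^1$ let $\sigma\cup\tau=R(W\sigma\wedge W\tau)\in C^2$, where $W$ is the Whitney embedding, $W[p,q]=\mu_p\,d\mu_q-\mu_q\,d\mu_p$ on an oriented edge ($\mu$ = barycentric coordinates), extended linearly, and $R$ is integration over simplices. Let $[M]$ be the fundamental class, i.e. the sum of the positively oriented triangles of $K$. Let $\langle\cdot,\cdot\rangle$ be a positive definite hermitian inner product on $C^1$, linear in the first variable. A cochain $\sigma\in C^1$ is harmonic if $\delta\sigma=0$ and $\langle\sigma,\delta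 f\rangle=0$ for all $f\in C^0$ (that is, $\delta^*\sigma=0$); let $H^1$ be the space of harmonic $1$-cochains. The star operator is defined by $\langle\bigstar a,b\rangle=(a\cup\bar b)[M]$ for all $b\in C^1$. On $H^1$ we use the induced operator, again denoted by $\bigstar:H^1\to H^1$, which sends $\sigma$ to the orthogonal projection of $\bigstar\sigma$ to $H^1$; equivalently $\langle\bigstar\sigma,\tau\rangle=(\sigma\cup\bar\tau)[M]$ for all $\tau\in H^1$. The space $\mathcal H^{1,0}$ of holomorphic $1$-cochains is the subspace of $H^1$ spanned by the $\sigma\in H^1$ with $\bigstar\sigma=-i\lambda\sigma$ for some real $\lambda\ge 0$. The periods of $\sigma$ are $A_i=\sigma(a_i)$, $B_i=\sigma(b_i)$; those of $\sigma'$ are $A_i'$, $B_i'$. *Theorem.* Suppose that $\langle\cdot,\cdot\rangle$ is the hermitian extension of a real inner product on the real-valued $1$-cochains, i.e. $\langle\bar a,\bar b\rangle=\overline{\langle a,b\rangle}$ for all $a,b\in C^1$. Then for all $\sigma,\sigma'\in\mathcal H^{1,0}$ $$\sum_{i=1}^g (A_iB_i'-B_iA_i')=0,$$ and if $\lambda\in\mathbb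 R$ is such that $\bigstar\sigma=-i\lambda\sigma$, then $$-i\lambda\langle\sigma,\overline{\sigma'}\rangle=\sum_{i=1}^g (A_iB_i'-B_iA_i')=0.$$ *Corollary.* Let $\langle\cdot,\cdot\rangle$ be an arbitrary positive definite hermitian inner product on $C^1$, and let $\sigma\in\mathcal H^{1,0}$ and $\lambda\in\mathbb R$ satisfy $\bigstar\sigma=-i\lambda\sigma$. If $\sigma\neq0$ then $\lambda>0$; and if $\lambda>0$, then $$\|\sigma\|^2=\langle\sigma,\sigma\rangle=\frac{i}{\lambda}\sum_{i=1}^g\bigl(A_i\overline{B_i}-B_i\overline{A_i}\bigr)\ge 0 .$$ -/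

import Mathlib

open scoped ComplexConjugate ComplexOrder

noncomputable section

namespace CombSurface

/-! ### Simplicial complexes and complex-valued cochains in degrees 0, 1, 2 -/

/-- The ordered pair `(u, v)` spans a `1`-simplex of `K`. -/
def IsEdge {V : Type*} [DecidableEq V] (K : AbstractSimplicialComplex V) (u v : V) : Prop :=
  u ≠ v ∧ ({u, v} : Finset V) ∈ K.faces

/-- The ordered triple `(u, v, w)` spans a `2`-simplex of `K`. -/
def IsTriangle {V : Type*} [DecidableEq V] (K : AbstractSimplicialComplex V) (u v w : V) : Prop :=
  u ≠ v ∧ u ≠ w ∧ v ≠ w ∧ ({u, v, w} : Finset V) ∈ K.faces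

theorem IsEdge.symm {V : Type*} [DecidableEq V] {K : AbstractSimplicialComplex V} {u v : V}
    (h : IsEdge K u v) : IsEdge K v u :=
  ⟨h.1.symm, by rw [Finset.pair_comm]; exact h.2⟩

theorem IsTriangle.swap_left {V : Type*} [DecidableEq V] {K : AbstractSimplicialComplex V}
    {u v w : V} (h : IsTriangle K u v w) : IsTriangle K v u w :=
  ⟨h.1.symm, h.2.2.1, h.2.1, by rw [Finset.insert_comm]; exact h.2.2.2⟩

theorem IsTriangle.swap_right {V : Type*} [DecidableEq V] {K : AbstractSimplicialComplex V}
    {u v w : V} (h : IsTriangle K u v w) : IsTriangle K u w v :=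
  ⟨h.2.1, h.1, h.2.2.1.symm, by rw [Finset.pair_comm]; exact h.2.2.2⟩

/-- The geometric realization of a finite simplicial complex: barycentric coordinates
supported on a simplex, with the topology induced from `ℝ^V`. -/
def Realization {V : Type*} [Fintype V] (K : AbstractSimplicialComplex V) : Type _ :=
  {x : V → ℝ // (∀ v, 0 ≤ x v) ∧ ∑ v, x v = 1 ∧ ∃ s ∈ K.faces, ∀ v, x v ≠ 0 → v ∈ s}

instance {V : Type*} [Fintype V] (K : AbstractSimplicialComplex V) :
    TopologicalSpace (Realization K) :=
  inferInstanceAs (TopologicalSpace {x : V → ℝ // (∀ v, 0 ≤ x v) ∧ ∑ v, x v = 1 ∧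
    ∃ s ∈ K.faces, ∀ v, x v ≠ 0 → v ∈ s})

/-- Complex `1`-cochains: `σ u v` is the value on the oriented edge `[u, v]`. -/
def Cochain1 {V : Type*} [DecidableEq V] (K : AbstractSimplicialComplex V) :
    Submodule ℂ (V → V → ℂ) where
  carrier := {σ | (∀ u v, σ v u = - σ u v) ∧ ∀ u v, ¬ IsEdge K u v → σ u v = 0}
  zero_mem' := by simp
  add_mem' := by
    rintro a b ⟨ha, ha'⟩ ⟨hb, hb'⟩
    refine ⟨fun u v => ?_, fun u v h => ?_⟩
    · simp only [Pi.add_apply, ha u v, hb u v]; ring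
    · simp only [Pi.add_apply, ha' u v h, hb' u v h, add_zero]
  smul_mem' := by
    rintro c a ⟨ha, ha'⟩
    refine ⟨fun u v => ?_, fun u v h => ?_⟩
    · simp only [Pi.smul_apply, ha u v, smul_neg]
    · simp only [Pi.smul_apply, ha' u v h, smul_zero]

/-- Complex `2`-cochains: `c u v w` is the value on the oriented triangle `[u, v, w]`. -/
def Cochain2 {V : Type*} [DecidableEq V] (K : AbstractSimplicialComplex V) :
    Submodule ℂ (V → V → V → ℂ) where
  carrier := {c | (∀ u v w, c v u w = - c u v w) ∧ (∀ u v w, c u w v = - c u v w) ∧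
    ∀ u v w, ¬ IsTriangle K u v w → c u v w = 0}
  zero_mem' := by simp
  add_mem' := by
    rintro a b ⟨ha, ha', ha''⟩ ⟨hb, hb', hb''⟩
    refine ⟨fun u v w => ?_, fun u v w => ?_, fun u v w h => ?_⟩
    · simp only [Pi.add_apply, ha u v w, hb u v w]; ring
    · simp only [Pi.add_apply, ha' u v w, hb' u v w]; ring
    · simp only [Pi.add_apply, ha'' u v w h, hb'' u v w h, add_zero]
  smul_mem' := by
    rintro k a ⟨ha, ha', ha''⟩
    refine ⟨fun u v w => ?_, fun u v w => ?_, fun u v w h => ?_⟩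
    · simp only [Pi.smul_apply, ha u v w, smul_neg]
    · simp only [Pi.smul_apply, ha' u v w, smul_neg]
    · simp only [Pi.smul_apply, ha'' u v w h, smul_zero]

open Classical in
/-- The coboundary `δ : C⁰ → C¹`; a `0`-cochain is a function on the vertices. -/
def delta0 {V : Type*} [DecidableEq V] (K : AbstractSimplicialComplex V) :
    (V → ℂ) →ₗ[ℂ] Cochain1 K where
  toFun f := ⟨fun u v => if IsEdge K u v then f v - f u else 0, by
    refine ⟨fun u v => ?_, fun u v h => if_neg h⟩
    by_cases h : IsEdge K u v
    · simp [h, h.symm]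
    · have h' : ¬ IsEdge K v u := fun h' => h h'.symm
      simp [h, h']⟩
  map_add' f f' := by
    ext u v
    by_cases h : IsEdge K u v
    · simp [h]; ring
    · simp [h]
  map_smul' c f := by
    ext u v
    by_cases h : IsEdge K u v
    · simp [h]; ring
    · simp [h]

open Classical in
/-- The coboundary `δ : C¹ → C²`. -/
def delta1 {V : Type*} [DecidableEq V] (K : AbstractSimplicialComplex V) :
    Cochain1 K →ₗ[ℂ] Cochain2 K where
  toFun σ := ⟨fun u v w => if IsTriangle K u v w then σ.1 v w - σ.1 u w + σ.1 u v else 0, by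
    refine ⟨fun u v w => ?_, fun u v w => ?_, fun u v w h => if_neg h⟩
    · by_cases h : IsTriangle K u v w
      · simp only [h, h.swap_left, if_true, σ.2.1 u v]; ring
      · have h' : ¬ IsTriangle K v u w := fun h' => h h'.swap_left
        simp [h, h']
    · by_cases h : IsTriangle K u v w
      · simp only [h, h.swap_right, if_true, σ.2.1 v w]; ring
      · have h' : ¬ IsTriangle K u w v := fun h' => h h'.swap_right
        simp [h, h']⟩
  map_add' f f' := by
    ext u v w
    by_cases h : IsTriangle K u v w
    · simp [h]; ring
    · simp [h]
  map_smul' c f := by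
    ext u v w
    by_cases h : IsTriangle K u v w
    · simp [h]; ring
    · simp [h]

/-- Complex conjugation of `1`-cochains. -/
def conjCochain {V : Type*} [DecidableEq V] {K : AbstractSimplicialComplex V}
    (σ : Cochain1 K) : Cochain1 K :=
  ⟨fun u v => conj (σ.1 u v), by
    refine ⟨fun u v => ?_, fun u v h => ?_⟩
    · simp only [σ.2.1 u v, map_neg]
    · simp only [σ.2.2 u v h, map_zero]⟩

/-! ### The Whitney cochain product -/

/-- The Whitney form `W σ = ∑_{i<j} σ([x i, x j]) (μ i dμ j - μ j dμ i)` of a `1`-cochain on the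
triangle `[x 0, x 1, x 2]`, at the point with barycentric coordinates `μ`, on the tangent
vector `ξ` (written in barycentric coordinates). -/
def whitneyForm {V : Type*} (σ : V → V → ℂ) (x : Fin 3 → V) (μ ξ : Fin 3 → ℝ) : ℂ :=
  ∑ i, ∑ j ∈ Finset.Ioi i, σ (x i) (x j) * ((μ i * ξ j - μ j * ξ i : ℝ) : ℂ)

/-- The integral of `W σ ∧ W τ` over the oriented triangle `[u, v, w]`, which is parametrized
by `(s, t) ↦ (1 - s - t) u + s v + t w` for `0 ≤ s ≤ 1`, `0 ≤ t ≤ 1 - s`. -/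
def whitneyIntegral {V : Type*} (σ τ : V → V → ℂ) (u v w : V) : ℂ :=
  ∫ s in (0 : ℝ)..1, ∫ t in (0 : ℝ)..(1 - s),
    (whitneyForm σ ![u, v, w] ![1 - s - t, s, t] ![-1, 1, 0] *
        whitneyForm τ ![u, v, w] ![1 - s - t, s, t] ![-1, 0, 1] -
      whitneyForm σ ![u, v, w] ![1 - s - t, s, t] ![-1, 0, 1] *
        whitneyForm τ ![u, v, w] ![1 - s - t, s, t] ![-1, 1, 0])

theorem integral_quadratic (A B C : ℂ) (b : ℝ) :
    ∫ x in (0 : ℝ)..b, (A + (x : ℂ) * B + (x : ℂ) ^ 2 * C) =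
      (b : ℂ) * A + (b : ℂ) ^ 2 / 2 * B + (b : ℂ) ^ 3 / 3 * C := by
  rw [intervalIntegral.integral_eq_sub_of_hasDerivAt
    (f := fun x : ℝ => (x : ℂ) * A + (x : ℂ) ^ 2 / 2 * B + (x : ℂ) ^ 3 / 3 * C)]
  · simp
  · intro x _
    have h1 : HasDerivAt (fun y : ℝ => (y : ℂ)) 1 x := Complex.ofRealCLM.hasDerivAt
    have h := ((h1.mul_const A).add (((h1.pow 2).div_const 2).mul_const B)).add
      (((h1.pow 3).div_const 3).mul_const C)
    refine h.congr_deriv ?_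
    norm_num
  · exact Continuous.intervalIntegrable (by fun_prop) _ _

theorem whitneyIntegral_eq {V : Type*} (σ τ : V → V → ℂ) (u v w : V) :
    whitneyIntegral σ τ u v w = (1 / 6 : ℂ) *
      ((σ u v * τ v w - σ v w * τ u v) + (σ u v * τ u w - σ u w * τ u v) +
        (σ u w * τ v w - σ v w * τ u w)) := by
  have h0 : Finset.Ioi (0 : Fin 3) = {1, 2} := by decide
  have h1 : Finset.Ioi (1 : Fin 3) = {2} := by decide
  have h2 : Finset.Ioi (2 : Fin 3) = ∅ := by decide
  set X := σ u v * τ v w - σ v w * τ u v with hX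
  set P := σ u v * τ u w - σ u w * τ u v with hP
  set Y := σ u w * τ v w - σ v w * τ u w with hY
  have e : ∀ s t : ℝ, (whitneyForm σ ![u, v, w] ![1 - s - t, s, t] ![-1, 1, 0] *
        whitneyForm τ ![u, v, w] ![1 - s - t, s, t] ![-1, 0, 1] -
      whitneyForm σ ![u, v, w] ![1 - s - t, s, t] ![-1, 0, 1] *
        whitneyForm τ ![u, v, w] ![1 - s - t, s, t] ![-1, 1, 0]) =
      (P + (s : ℂ) * (X - P)) + (t : ℂ) * (Y - P) + (t : ℂ) ^ 2 * 0 := by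
    intro s t
    simp [whitneyForm, Fin.sum_univ_three, h0, h1, h2, hX, hP, hY]
    ring
  have e' : ∀ s : ℝ, ((1 - s : ℝ) : ℂ) * (P + (s : ℂ) * (X - P)) +
      ((1 - s : ℝ) : ℂ) ^ 2 / 2 * (Y - P) + ((1 - s : ℝ) : ℂ) ^ 3 / 3 * 0 =
      (P + (Y - P) / 2) + (s : ℂ) * ((X - P) - P - (Y - P)) +
        (s : ℂ) ^ 2 * ((Y - P) / 2 - (X - P)) := by
    intro s
    push_cast
    ring
  simp only [whitneyIntegral, e, integral_quadratic, e']
  norm_num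
  ring

open Classical in
/-- The cochain product `σ ∪ τ = R (W σ ∧ W τ)` of two `1`-cochains, where `R` integrates forms
over the simplices of `K`. -/
def cup {V : Type*} [DecidableEq V] {K : AbstractSimplicialComplex V} (σ τ : Cochain1 K) :
    Cochain2 K :=
  ⟨fun u v w => if IsTriangle K u v w then whitneyIntegral σ.1 τ.1 u v w else 0, by
    refine ⟨fun u v w => ?_, fun u v w => ?_, fun u v w h => if_neg h⟩
    · by_cases h : IsTriangle K u v w
      · simp only [h, h.swap_left, if_true, whitneyIntegral_eq, σ.2.1 u v, τ.2.1 u v]; ring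
      · have h' : ¬ IsTriangle K v u w := fun h' => h h'.swap_left
        simp [h, h']
    · by_cases h : IsTriangle K u v w
      · simp only [h, h.swap_right, if_true, whitneyIntegral_eq, σ.2.1 v w, τ.2.1 v w]; ring
      · have h' : ¬ IsTriangle K u w v := fun h' => h h'.swap_right
        simp [h, h']⟩

/-! ### Orientation and fundamental class -/

/-- An orientation of a closed triangulated surface: a choice of orientation of every triangle
(`coeff u v w = 1` if `[u, v, w]` is positively oriented and `-1` if it is negatively oriented)
such that the sum of the oriented triangles is a cycle. -/
structure SurfaceOrientation {V : Type*} [Fintype V] [DecidableEq V]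
    (K : AbstractSimplicialComplex V) where
  coeff : V → V → V → ℤ
  swap_left : ∀ u v w, coeff v u w = - coeff u v w
  swap_right : ∀ u v w, coeff u w v = - coeff u v w
  eq_zero : ∀ u v w, ¬ IsTriangle K u v w → coeff u v w = 0
  eq_one_or : ∀ u v w, IsTriangle K u v w → coeff u v w = 1 ∨ coeff u v w = -1
  cycle : ∀ u v, ∑ w, coeff u v w = 0

/-- Evaluation of a `2`-cochain on the fundamental class `[M]`, the sum of the positively oriented
triangles (each triangle occurs in the sum with its six orderings). -/
def evalFund {V : Type*} [Fintype V] [DecidableEq V] {K : AbstractSimplicialComplex V}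
    (o : SurfaceOrientation K) (c : Cochain2 K) : ℂ :=
  (1 / 6 : ℂ) * ∑ u, ∑ v, ∑ w, (o.coeff u v w : ℂ) * c.1 u v w

/-! ### Surfaces of genus `g` glued from a triangulated `4g`-gon -/

/-- `CanonicalPolygon K o g` says that the oriented complex `K` is a closed oriented surface of
genus `g` obtained by identifying the sides of a `4g`-gon, and that `K` is a subdivision of the
resulting cell decomposition.

The polygon is a triangulated closed disc `D`. Its sides, in counterclockwise order, are
`a_0, b_0, a_0⁻¹, b_0⁻¹, a_1, b_1, a_1⁻¹, b_1⁻¹, …`. The side `a_i` (respectively `b_i`) is the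
edge path `side i 0 0, …, side i 0 (len i 0)` (respectively `side i 1`), traversed
counterclockwise; the opposite side `a_i⁻¹` (respectively `b_i⁻¹`) is
`opp i 0 0, …, opp i 0 (len i 0)` (respectively `opp i 1`), traversed clockwise. The simplicial
map `proj : D → K` glues `side i s k` to `opp i s k`, and identifies nothing else. -/
structure CanonicalPolygon {V W : Type*} [Fintype V] [DecidableEq V] [Fintype W] [DecidableEq W]
    (K : AbstractSimplicialComplex V) (o : SurfaceOrientation K) (g : ℕ) [NeZero g]
    (D : AbstractSimplicialComplex W) where
  /-- `D` triangulates a closed disc. -/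
  disc : Nonempty (Realization D ≃ₜ Metric.closedBall (0 : EuclideanSpace ℝ (Fin 2)) 1)
  len : Fin g → Fin 2 → ℕ
  side : Fin g → Fin 2 → ℕ → W
  opp : Fin g → Fin 2 → ℕ → W
  len_pos : ∀ i s, 0 < len i s
  /-- The sides are consecutive, -/
  corner_a_b : ∀ i, side i 0 (len i 0) = side i 1 0
  corner_b_a' : ∀ i, side i 1 (len i 1) = opp i 0 (len i 0)
  corner_a'_b' : ∀ i, opp i 0 0 = opp i 1 (len i 1)
  corner_b'_a : ∀ i, opp i 1 0 = side (i + 1) 0 0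
  /-- they pass through each vertex at most once, -/
  side_inj : ∀ i s k i' s' k', k < len i s → k' < len i' s' →
    side i s k = side i' s' k' → i = i' ∧ s = s' ∧ k = k'
  opp_inj : ∀ i s k i' s' k', k < len i s → k' < len i' s' →
    opp i s (k + 1) = opp i' s' (k' + 1) → i = i' ∧ s = s' ∧ k = k'
  side_ne_opp : ∀ i s k i' s' k', k < len i s → k' < len i' s' →
    side i s k ≠ opp i' s' (k' + 1)
  side_edge : ∀ i s k, k < len i s → IsEdge D (side i s k) (side i s (k + 1))
  opp_edge : ∀ i s k, k < len i s → IsEdge D (opp i s k) (opp i s (k + 1))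
  /-- and they run through the boundary of the disc: the edges that lie in exactly one triangle
  are those on the sides. -/
  boundary_edge : ∀ u v, IsEdge D u v →
    ((∃! w, IsTriangle D u v w) ↔ ∃ i s k, k < len i s ∧
      (({u, v} : Finset W) = {side i s k, side i s (k + 1)} ∨
        ({u, v} : Finset W) = {opp i s k, opp i s (k + 1)}))
  proj : W → V
  /-- `proj` is simplicial, injective on each simplex, and maps onto `K`. -/
  proj_mem : ∀ s ∈ D.faces, s.image proj ∈ K.faces
  proj_injOn : ∀ s ∈ D.faces, Set.InjOn proj (s : Set W)
  proj_surj : ∀ t ∈ K.faces, ∃ s ∈ D.faces, s.image proj = t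
  /-- Two vertices have the same image exactly if the side identifications force it. -/
  glue_vertex : ∀ w w', proj w = proj w' ↔
    Relation.EqvGen (fun x y => ∃ i s k, k ≤ len i s ∧ x = side i s k ∧ y = opp i s k) w w'
  /-- Two different edges have the same image only if they are paired edges of opposite sides. -/
  glue_edge : ∀ u v u' v', IsEdge D u v → IsEdge D u' v' → proj u = proj u' → proj v = proj v' →
    (u = u' ∧ v = v') ∨ ∃ i s k, k < len i s ∧
      ((({u, v} : Finset W) = {side i s k, side i s (k + 1)} ∧
          ({u', v'} : Finset W) = {opp i s k, opp i s (k + 1)}) ∨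
        (({u, v} : Finset W) = {opp i s k, opp i s (k + 1)} ∧
          ({u', v'} : Finset W) = {side i s k, side i s (k + 1)}))
  /-- No two different triangles have the same image. -/
  glue_triangle : ∀ s ∈ D.faces, ∀ s' ∈ D.faces, s.card = 3 → s.image proj = s'.image proj → s = s'
  /-- The orientation of `K` lifts to the orientation of the polygon whose boundary is
  counterclockwise: the coefficient of `[u, v]` in the boundary of the lifted fundamental chain is
  the coefficient of `[u, v]` in `∑ (a_i + b_i - a_i' - b_i')`. -/
  oriented : ∀ u v,
    (∑ w, open Classical in if IsTriangle D u v w then o.coeff (proj u) (proj v) (proj w) else 0) =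
      ∑ i, ∑ s, ∑ k ∈ Finset.range (len i s),
        ((if (u, v) = (side i s k, side i s (k + 1)) then (1 : ℤ) else 0)
          - (if (v, u) = (side i s k, side i s (k + 1)) then (1 : ℤ) else 0)
          - (if (u, v) = (opp i s k, opp i s (k + 1)) then (1 : ℤ) else 0)
          + (if (v, u) = (opp i s k, opp i s (k + 1)) then (1 : ℤ) else 0))

namespace CanonicalPolygon

variable {V W : Type*} [Fintype V] [DecidableEq V] [Fintype W] [DecidableEq W]
  {K : AbstractSimplicialComplex V} {o : SurfaceOrientation K} {g : ℕ} [NeZero g]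
  {D : AbstractSimplicialComplex W}

/-- The value of a cochain on the cycle `a_i` (`s = 0`) or `b_i` (`s = 1`) of the canonical
homology basis: the sum of its values over the edges into which the cycle is subdivided. -/
def period (P : CanonicalPolygon K o g D) (σ : Cochain1 K) (i : Fin g) (s : Fin 2) : ℂ :=
  ∑ k ∈ Finset.range (P.len i s), σ.1 (P.proj (P.side i s k)) (P.proj (P.side i s (k + 1)))

/-- The `A`-periods `A_i = σ(a_i)`. -/
def periodA (P : CanonicalPolygon K o g D) (σ : Cochain1 K) (i : Fin g) : ℂ := P.period σ i 0

/-- The `B`-periods `B_i = σ(b_i)`. -/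
def periodB (P : CanonicalPolygon K o g D) (σ : Cochain1 K) (i : Fin g) : ℂ := P.period σ i 1

end CanonicalPolygon

/-! ### Hermitian inner products, harmonic cochains and the star operator -/

theorem riesz_core {E : Type*} [AddCommGroup E] [Module ℂ E] [FiniteDimensional ℂ E]
    (ip : InnerProductSpace.Core ℂ E) (φ : E →ₗ[ℂ] ℂ) : ∃! v : E, ∀ b, ip.inner v b = φ b := by
  let _ : NormedAddCommGroup E := ip.toNormedAddCommGroup
  let _ : InnerProductSpace ℂ E := InnerProductSpace.ofCore ip.toCore
  have _ : CompleteSpace E := FiniteDimensional.complete ℂ E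
  refine ⟨(InnerProductSpace.toDual ℂ E).symm (LinearMap.toContinuousLinearMap φ), ?_, ?_⟩
  · intro b
    exact InnerProductSpace.toDual_symm_apply
  · intro v hv
    apply (InnerProductSpace.toDual ℂ E).injective
    ext b
    simp only [LinearIsometryEquiv.apply_symm_apply]
    exact hv b

theorem evalFund_cup_conj_add {V : Type*} [Fintype V] [DecidableEq V]
    {K : AbstractSimplicialComplex V} (o : SurfaceOrientation K) (a b c : Cochain1 K) :
    evalFund o (cup a (conjCochain (b + c))) =
      evalFund o (cup a (conjCochain b)) + evalFund o (cup a (conjCochain c)) := by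
  simp only [evalFund, ← mul_add, ← Finset.sum_add_distrib]
  congr 1
  refine Finset.sum_congr rfl fun u _ => Finset.sum_congr rfl fun v _ =>
    Finset.sum_congr rfl fun w _ => ?_
  by_cases h : IsTriangle K u v w
  · simp only [cup, h, if_true, whitneyIntegral_eq, conjCochain, Submodule.coe_add,
      Pi.add_apply, map_add]
    ring
  · simp [cup, h]

theorem evalFund_cup_conj_smul {V : Type*} [Fintype V] [DecidableEq V]
    {K : AbstractSimplicialComplex V} (o : SurfaceOrientation K) (z : ℂ) (a b : Cochain1 K) :
    evalFund o (cup a (conjCochain (z • b))) = conj z * evalFund o (cup a (conjCochain b)) := by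
  simp only [evalFund, mul_left_comm (conj z), Finset.mul_sum]
  refine Finset.sum_congr rfl fun u _ => Finset.sum_congr rfl fun v _ =>
    Finset.sum_congr rfl fun w _ => ?_
  by_cases h : IsTriangle K u v w
  · simp only [cup, h, if_true, whitneyIntegral_eq, conjCochain, Submodule.coe_smul,
      Pi.smul_apply, smul_eq_mul, map_mul]
    ring
  · simp [cup, h]

section Hodge

variable {V : Type*} [Fintype V] [DecidableEq V] {K : AbstractSimplicialComplex V}

/-- The hermitian inner product `⟨a, b⟩`, linear in `a` and conjugate linear in `b`.
(Mathlib's convention for `ip.inner` is the opposite one.) -/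
def herm (ip : InnerProductSpace.Core ℂ (Cochain1 K)) (a b : Cochain1 K) : ℂ := ip.inner b a

/-- The norm `‖a‖` of the hermitian inner product. -/
def hermNorm (ip : InnerProductSpace.Core ℂ (Cochain1 K)) (a : Cochain1 K) : ℝ :=
  Real.sqrt (herm ip a a).re

/-- The hermitian inner product is the hermitian extension of a real inner product on the
real-valued cochains. -/
def IsComplexification (ip : InnerProductSpace.Core ℂ (Cochain1 K)) : Prop :=
  ∀ a b, herm ip (conjCochain a) (conjCochain b) = conj (herm ip a b)

/-- The harmonic `1`-cochains: `δ σ = 0` and `δ* σ = 0`. The second condition, for the adjoint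
`δ*` of `δ : C⁰ → C¹`, says that `σ` is orthogonal to the image of `δ`, whatever the inner product
on `C⁰` is. -/
def harmonic (ip : InnerProductSpace.Core ℂ (Cochain1 K)) : Submodule ℂ (Cochain1 K) where
  carrier := {σ | delta1 K σ = 0 ∧ ∀ f : V → ℂ, herm ip σ (delta0 K f) = 0}
  zero_mem' := by
    refine ⟨map_zero _, fun f => ?_⟩
    have h := ip.smul_left 0 (delta0 K f) 0
    rw [zero_smul, map_zero, zero_mul] at h
    rw [herm, ← ip.conj_inner_symm, h, map_zero]
  add_mem' := by
    rintro a b ⟨ha, ha'⟩ ⟨hb, hb'⟩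
    refine ⟨by rw [map_add, ha, hb, add_zero], fun f => ?_⟩
    have ha'' := ha' f
    have hb'' := hb' f
    simp only [herm] at ha'' hb'' ⊢
    rw [← ip.conj_inner_symm, ip.add_left, map_add, ip.conj_inner_symm, ip.conj_inner_symm,
      ha'', hb'', add_zero]
  smul_mem' := by
    rintro z a ⟨ha, ha'⟩
    refine ⟨by rw [map_smul, ha, smul_zero], fun f => ?_⟩
    have ha'' := ha' f
    simp only [herm] at ha'' ⊢
    rw [← ip.conj_inner_symm, ip.smul_left, map_mul, ip.conj_inner_symm, ha'', mul_zero]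

theorem exists_star (o : SurfaceOrientation K) (ip : InnerProductSpace.Core ℂ (Cochain1 K))
    (a : Cochain1 K) :
    ∃! s : Cochain1 K, ∀ b, herm ip s b = evalFund o (cup a (conjCochain b)) := by
  have key := riesz_core ip
    { toFun := fun b => conj (evalFund o (cup a (conjCochain b)))
      map_add' := fun b c => by rw [evalFund_cup_conj_add, map_add]
      map_smul' := fun z b => by
        rw [evalFund_cup_conj_smul, map_mul, Complex.conj_conj, RingHom.id_apply, smul_eq_mul] }
  have hiff : ∀ s : Cochain1 K, (∀ b, herm ip s b = evalFund o (cup a (conjCochain b))) ↔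
      ∀ b, ip.inner s b = conj (evalFund o (cup a (conjCochain b))) := by
    intro s
    refine forall_congr' fun b => ?_
    rw [← ip.conj_inner_symm s b, herm]
    exact (starRingEnd ℂ).injective.eq_iff.symm
  simp only [hiff]
  exact key

/-- The combinatorial star operator: `⟨★ a, b⟩ = (a ∪ b̄)[M]` for all `1`-cochains `b`. -/
def star (o : SurfaceOrientation K) (ip : InnerProductSpace.Core ℂ (Cochain1 K))
    (a : Cochain1 K) : Cochain1 K :=
  (exists_star o ip a).choose

theorem star_spec (o : SurfaceOrientation K) (ip : InnerProductSpace.Core ℂ (Cochain1 K))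
    (a b : Cochain1 K) : herm ip (star o ip a) b = evalFund o (cup a (conjCochain b)) :=
  (exists_star o ip a).choose_spec.1 b

theorem exists_harmonicPart (ip : InnerProductSpace.Core ℂ (Cochain1 K)) (a : Cochain1 K) :
    ∃ s ∈ harmonic ip, ∀ b ∈ harmonic ip, herm ip s b = herm ip a b := by
  let ipH : InnerProductSpace.Core ℂ (harmonic ip) :=
    { inner := fun x y => ip.inner x.1 y.1
      conj_inner_symm := fun x y => ip.conj_inner_symm x.1 y.1
      re_inner_nonneg := fun x => ip.re_inner_nonneg x.1
      add_left := fun x y z => ip.add_left x.1 y.1 z.1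
      smul_left := fun x y r => ip.smul_left x.1 y.1 r
      definite := fun x hx => Subtype.ext (ip.definite x.1 hx) }
  obtain ⟨s, hs, -⟩ := riesz_core ipH
    { toFun := fun b => ip.inner a b.1
      map_add' := fun b c => by
        rw [← ip.conj_inner_symm, Submodule.coe_add, ip.add_left, map_add, ip.conj_inner_symm,
          ip.conj_inner_symm]
      map_smul' := fun z b => by
        rw [← ip.conj_inner_symm, Submodule.coe_smul, ip.smul_left, map_mul, ip.conj_inner_symm,
          Complex.conj_conj, RingHom.id_apply, smul_eq_mul] }
  refine ⟨s.1, s.2, fun b hb => ?_⟩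
  have h : ip.inner s.1 b = ip.inner a b := hs ⟨b, hb⟩
  rw [herm, herm, ← ip.conj_inner_symm, h, ip.conj_inner_symm]

/-- The harmonic part of a `1`-cochain: its orthogonal projection to the harmonic cochains. -/
def harmonicPart (ip : InnerProductSpace.Core ℂ (Cochain1 K)) (a : Cochain1 K) : Cochain1 K :=
  (exists_harmonicPart ip a).choose

theorem harmonicPart_mem (ip : InnerProductSpace.Core ℂ (Cochain1 K)) (a : Cochain1 K) :
    harmonicPart ip a ∈ harmonic ip :=
  (exists_harmonicPart ip a).choose_spec.1

theorem herm_harmonicPart (ip : InnerProductSpace.Core ℂ (Cochain1 K)) (a : Cochain1 K)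
    {b : Cochain1 K} (hb : b ∈ harmonic ip) : herm ip (harmonicPart ip a) b = herm ip a b :=
  (exists_harmonicPart ip a).choose_spec.2 b hb

/-- The star operator induced on harmonic `1`-cochains: Poincaré duality followed by the inverse of
the inner product on the harmonic cochains, that is, the harmonic part of `★ σ`. -/
def harmonicStar (o : SurfaceOrientation K) (ip : InnerProductSpace.Core ℂ (Cochain1 K))
    (σ : Cochain1 K) : Cochain1 K :=
  harmonicPart ip (star o ip σ)

theorem harmonicPart_of_mem (ip : InnerProductSpace.Core ℂ (Cochain1 K)) {a : Cochain1 K}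
    (ha : a ∈ harmonic ip) : harmonicPart ip a = a := by
  have hd : harmonicPart ip a - a ∈ harmonic ip := sub_mem (harmonicPart_mem ip a) ha
  have h : herm ip (harmonicPart ip a) (harmonicPart ip a - a) =
      herm ip a (harmonicPart ip a - a) := herm_harmonicPart ip a hd
  have h0 : ip.inner (harmonicPart ip a - a) (harmonicPart ip a - a) = 0 := by
    have h1 := ip.add_left (harmonicPart ip a - a) a (harmonicPart ip a - a)
    rw [sub_add_cancel, ← ip.conj_inner_symm (harmonicPart ip a),
      ← ip.conj_inner_symm a (harmonicPart ip a - a)] at h1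
    simp only [herm] at h
    rw [h] at h1
    simpa using h1
  exact sub_eq_zero.mp (ip.definite _ h0)

/-- If the full star operator satisfies `★ σ = c σ` on a harmonic cochain, then so does the
induced one. -/
theorem harmonicStar_eq_of_star_eq (o : SurfaceOrientation K)
    (ip : InnerProductSpace.Core ℂ (Cochain1 K)) {σ : Cochain1 K} (hσ : σ ∈ harmonic ip) {c : ℂ}
    (h : star o ip σ = c • σ) : harmonicStar o ip σ = c • σ := by
  rw [harmonicStar, h]
  exact harmonicPart_of_mem ip ((harmonic ip).smul_mem c hσ)

/-- The space `ℋ^{1,0}` of holomorphic `1`-cochains: the subspace spanned by the harmonic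
`1`-cochains `σ` with `★ σ = -i λ σ` for some real `λ ≥ 0`, where `★` is the star operator induced
on harmonic cochains. -/
def holomorphic (o : SurfaceOrientation K) (ip : InnerProductSpace.Core ℂ (Cochain1 K)) :
    Submodule ℂ (Cochain1 K) :=
  Submodule.span ℂ {σ | σ ∈ harmonic ip ∧
    ∃ lam : ℝ, 0 ≤ lam ∧ harmonicStar o ip σ = (-Complex.I * lam) • σ}

end Hodge

end CombSurface
end

/-! The whole theorem rests on one identity (`CanonicalPolygon.evalFund_cup`): for closed `σ` and
`τ`, `(σ ∪ τ)[M]` is the period form `Q(σ, τ) = ∑ (A_i B_i' - B_i A_i')`. Since the polygon is a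
disc, `σ` has a potential `f` there. The Whitney product of `δf` and the lift of `τ` is then the
coboundary of an explicit 1-cochain built from `f` and `τ`, so discrete Stokes leaves a sum over the
boundary edges. Paired sides carry the same `τ`, while `f` jumps by the constant `B_i` across `a_i`
and `-A_i` across `b_i`; summing gives `Q`. Exactness on the disc is deduced from the bare
homeomorphism with a ball by integrating a local cocycle along radial segments.

On harmonic cochains therefore `⟨★σ, τ⟩ = Q(σ, τ̄)`, and `★σ = -iλσ` gives `-iλ⟨σ, τ⟩ = Q(σ, τ̄)`.
For a real inner product `⟨σ, τ̄⟩` is symmetric whereas `Q` is antisymmetric. Eigencochains with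
parameters `a, b ≥ 0` thus satisfy `(a + b)⟨σ, τ̄⟩ = 0`, so `Q(σ, τ) = 0`; bilinearity extends this
to the span.

For the corollary, `★` is skew-adjoint, so eigencochains with different parameters are orthogonal.
One with `λ < 0` would be orthogonal to all of `ℋ^{1,0}`, which contains it. The value `λ = 0` is
excluded by Poincaré duality, proved by constructing closed cochains with arbitrary periods and
showing that vanishing periods force exactness. The norm formula is the case `τ = σ`. -/

namespace CombSurface

/-! ### Closed `1`-cochains on a triangulated compact convex set are exact -/

/-- A local cocycle on a bounded convex set is locally the coboundary of a function. -/
theorem exists_primitive_of_local_cocycle {E : Type*} [NormedAddCommGroup E] [NormedSpace ℝ E]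
    {s : Set E} (hs : Convex ℝ s) (hb : Bornology.IsBounded s) (x₀ : s) (ω : s → s → ℂ) {ε : ℝ}
    (hε : 0 < ε)
    (hω : ∀ x y z : s, dist x y < ε → dist x z < ε → ω x y + ω y z = ω x z) :
    ∃ F : s → ℂ, ∃ d > 0, ∀ x y : s, dist x y < d → F y - F x = ω x y := by
  obtain ⟨R, hR⟩ := hb.subset_ball x₀.1
  have hR0 : 0 < R := by
    have := hR x₀.2
    simpa using this
  obtain ⟨N, hN⟩ := exists_nat_gt (R / (ε / 2))
  have hN0 : 0 < (N : ℝ) := lt_trans (by positivity) hN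
  have hRN : R / N < ε / 2 := by
    rw [div_lt_iff₀ (by positivity)] at hN
    rw [div_lt_iff₀ hN0]
    linarith
  -- Clamping at `1` keeps every sample point in `s`, so the telescoping identity `key` holds for
  -- all `m`, not just `m ≤ N`.
  let t : ℕ → ℝ := fun k => min ((k : ℝ) / N) 1
  have ht0 : ∀ k, 0 ≤ t k := fun k => le_min (by positivity) zero_le_one
  have ht1 : ∀ k, t k ≤ 1 := fun k => min_le_right _ _
  have htt : ∀ k, |t k - t (k + 1)| ≤ 1 / N := by
    intro k
    refine (abs_min_sub_min_le_max _ _ _ _).trans ?_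
    have : ((k : ℝ) / N - ((k + 1 : ℕ) : ℝ) / N) = -(1 / N) := by push_cast; ring
    rw [this, abs_neg, abs_of_pos (by positivity), sub_self, abs_zero]
    exact max_le le_rfl (by positivity)
  let p : ℕ → s → s := fun k x => ⟨AffineMap.lineMap x₀.1 x.1 (t k),
    hs.lineMap_mem x₀.2 x.2 ⟨ht0 k, ht1 k⟩⟩
  have hpp : ∀ k x, dist (p k x) (p (k + 1) x) < ε / 2 := by
    intro k x
    have hx : dist x₀.1 x.1 ≤ R := by
      have := hR x.2
      rw [Metric.mem_ball, dist_comm] at this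
      exact this.le
    calc dist (p k x) (p (k + 1) x) = dist (t k) (t (k + 1)) * dist x₀.1 x.1 :=
          dist_lineMap_lineMap _ _ _ _
      _ ≤ 1 / N * R := by
          rw [Real.dist_eq]
          exact mul_le_mul (htt k) hx dist_nonneg (by positivity)
      _ = R / N := by ring
      _ < ε / 2 := hRN
  have hpq : ∀ k x y, dist (p k x) (p k y) ≤ dist x y := by
    intro k x y
    have h : dist (p k x) (p k y) = t k * dist x y := by
      change dist (AffineMap.lineMap x₀.1 x.1 (t k)) (AffineMap.lineMap x₀.1 y.1 (t k)) = _
      rw [dist_eq_norm, AffineMap.lineMap_apply_module, AffineMap.lineMap_apply_module,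
        Subtype.dist_eq, dist_eq_norm, add_sub_add_left_eq_sub, ← smul_sub, norm_smul,
        Real.norm_of_nonneg (ht0 k)]
    rw [h]
    exact mul_le_of_le_one_left dist_nonneg (ht1 k)
  have hp0 : ∀ x, p 0 x = x₀ := fun x => Subtype.ext (by simp [p, t])
  have hpN : ∀ x, p N x = x := fun x => Subtype.ext (by simp [p, t, hN0.ne'])
  -- `F x` integrates `ω` along the segment from `x₀` to `x`, in `N` steps shorter than `ε / 2`.
  refine ⟨fun x => ∑ k ∈ Finset.range N, ω (p k x) (p (k + 1) x), ε / 2, by positivity, ?_⟩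
  intro x y hxy
  -- The two segments form a ladder. Splitting each quadrilateral along its diagonal, which is
  -- shorter than `ε`, makes the difference telescope to the last rung minus the first.
  have key : ∀ m, ∑ k ∈ Finset.range m, ω (p k y) (p (k + 1) y) -
      ∑ k ∈ Finset.range m, ω (p k x) (p (k + 1) x) =
      ω (p m x) (p m y) - ω (p 0 x) (p 0 y) := by
    intro m
    induction m with
    | zero => simp
    | succ k ih =>
      have hk := hpq k x y
      have hk1 := hpq (k + 1) x y
      have hx := hpp k x
      have hy := hpp k y
      have htri : dist (p k x) (p (k + 1) y) < ε :=
        (dist_triangle _ _ _).trans_lt (by linarith : dist (p k x) (p k y) +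
          dist (p k y) (p (k + 1) y) < ε)
      have e1 := hω (p k x) (p k y) (p (k + 1) y) (by linarith) htri
      have e2 := hω (p k x) (p (k + 1) x) (p (k + 1) y) (by linarith) htri
      rw [Finset.sum_range_succ, Finset.sum_range_succ]
      linear_combination ih + e1 - e2
  have h00 := hω x₀ x₀ x₀ (by simpa using hε) (by simpa using hε)
  have := key N
  rw [hp0, hp0, hpN, hpN] at this
  rw [this]
  linear_combination -h00

/-! ### Closed and exact cochains, simplex by simplex -/

theorem mem_faces_of_subset {W : Type*} {D : AbstractSimplicialComplex W} {s t : Finset W}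
    (hs : s ∈ D.faces) (hts : t ⊆ s) (ht : t.Nonempty) : t ∈ D.faces :=
  (D.isRelLowerSet_faces hs).2 hts ht

variable {W : Type*} [DecidableEq W] {D : AbstractSimplicialComplex W}

theorem apply_self (σ : Cochain1 D) (u : W) : σ.1 u u = 0 :=
  σ.2.2 u u fun h => h.1 rfl

theorem delta1_apply_of_isTriangle (σ : Cochain1 D) {u v w : W} (h : IsTriangle D u v w) :
    (delta1 D σ).1 u v w = σ.1 v w - σ.1 u w + σ.1 u v := if_pos h

theorem delta0_apply_of_isEdge (f : W → ℂ) {u v : W} (h : IsEdge D u v) :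
    (delta0 D f).1 u v = f v - f u := if_pos h

theorem cocycle_of_isTriangle {σ : Cochain1 D} (hσ : delta1 D σ = 0) {u v w : W}
    (h : IsTriangle D u v w) : σ.1 u v + σ.1 v w = σ.1 u w := by
  have h1 := delta1_apply_of_isTriangle σ h
  rw [hσ] at h1
  have h2 : (0 : ℂ) = σ.1 v w - σ.1 u w + σ.1 u v := h1
  linear_combination -h2

/-- A closed cochain is additive on any three vertices of a simplex. -/
theorem cocycle_of_mem_faces {σ : Cochain1 D} (hσ : delta1 D σ = 0) {t : Finset W}
    (ht : t ∈ D.faces) {u v w : W} (hu : u ∈ t) (hv : v ∈ t) (hw : w ∈ t) :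
    σ.1 u v + σ.1 v w = σ.1 u w := by
  by_cases huv : u = v
  · subst huv; rw [apply_self σ, zero_add]
  by_cases hvw : v = w
  · subst hvw; rw [apply_self σ, add_zero]
  by_cases huw : u = w
  · subst huw; rw [apply_self σ, σ.2.1 u v]; ring
  refine cocycle_of_isTriangle hσ ⟨huv, huw, hvw, mem_faces_of_subset ht ?_ ⟨u, by simp⟩⟩
  intro x hx
  simp only [Finset.mem_insert, Finset.mem_singleton] at hx
  rcases hx with rfl | rfl | rfl <;> assumption

theorem eq_delta0_iff {σ : Cochain1 D} {f : W → ℂ} :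
    σ = delta0 D f ↔ ∀ u v, IsEdge D u v → σ.1 u v = f v - f u := by
  constructor
  · rintro rfl u v h
    exact delta0_apply_of_isEdge f h
  · intro h
    ext u v
    by_cases he : IsEdge D u v
    · rw [h u v he, delta0_apply_of_isEdge f he]
    · rw [σ.2.2 u v he, (delta0 D f).2.2 u v he]

theorem delta1_eq_zero_iff {σ : Cochain1 D} :
    delta1 D σ = 0 ↔ ∀ u v w, IsTriangle D u v w → σ.1 u v + σ.1 v w = σ.1 u w := by
  refine ⟨fun h u v w => cocycle_of_isTriangle h, fun h => ?_⟩
  ext u v w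
  by_cases ht : IsTriangle D u v w
  · rw [delta1_apply_of_isTriangle σ ht]
    change _ = (0 : ℂ)
    linear_combination h u v w ht
  · exact (delta1 D σ).2.2.2 u v w ht

/-- The open vertex stars cover the compact set `s`, so below a Lebesgue number two points share a
star and `σ` induces a local cocycle on `s`. Its primitive, evaluated at the vertices, is the
required 0-cochain. -/
theorem exists_eq_delta0_of_homeomorph_convex [Fintype W] {E : Type*} [NormedAddCommGroup E]
    [NormedSpace ℝ E] {s : Set E} (hs : Convex ℝ s) (hc : IsCompact s)
    (φ : Realization D ≃ₜ s) {σ : Cochain1 D} (hσ : delta1 D σ = 0) :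
    ∃ f : W → ℂ, σ = delta0 D f := by
  classical
  have hsupp : ∀ x : s, ∃ t ∈ D.faces, ∀ v, (φ.symm x).1 v ≠ 0 → v ∈ t :=
    fun x => (φ.symm x).2.2.2
  have hex : ∀ x : s, ∃ v, (φ.symm x).1 v ≠ 0 := by
    intro x
    by_contra! h
    have h1 := (φ.symm x).2.2.1
    simp only [h, Finset.sum_const_zero] at h1
    exact zero_ne_one h1
  choose v hv using hex
  have hcont : ∀ w, Continuous fun x : s => (φ.symm x).1 w := fun w =>
    ((continuous_apply w).comp continuous_subtype_val).comp φ.symm.continuous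
  have : CompactSpace s := isCompact_iff_compactSpace.mp hc
  obtain ⟨ε, hε, hleb⟩ := lebesgue_number_lemma_of_metric (s := (Set.univ : Set s))
    (c := fun w => {x : s | (φ.symm x).1 w ≠ 0}) isCompact_univ
    (fun w => isOpen_ne_fun (hcont w) continuous_const)
    (fun x _ => Set.mem_iUnion.mpr ⟨v x, hv x⟩)
  choose c hcc using fun x : s => hleb x (Set.mem_univ x)
  have cocyc : ∀ (x : s) (a b d : W), (φ.symm x).1 a ≠ 0 → (φ.symm x).1 b ≠ 0 →
      (φ.symm x).1 d ≠ 0 → σ.1 a b + σ.1 b d = σ.1 a d := by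
    intro x a b d ha hb hd
    obtain ⟨t, ht, h⟩ := hsupp x
    exact cocycle_of_mem_faces hσ ht (h a ha) (h b hb) (h d hd)
  -- Go from the vertex chosen for `x` to that of `y` through a vertex whose star contains the
  -- `ε`-ball at `x`. By `hω` any vertex common to both supports gives the same value; for distant
  -- points the value is irrelevant.
  let ω : s → s → ℂ := fun x y => σ.1 (v x) (c x) + σ.1 (c x) (v y)
  have hω : ∀ (x y : s) (w : W), dist x y < ε → (φ.symm x).1 w ≠ 0 → (φ.symm y).1 w ≠ 0 →
      ω x y = σ.1 (v x) w + σ.1 w (v y) := by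
    intro x y w hxy hx hy
    have hcx : (φ.symm x).1 (c x) ≠ 0 := hcc x (Metric.mem_ball_self hε)
    have hcy : (φ.symm y).1 (c x) ≠ 0 := hcc x (by rwa [Metric.mem_ball, dist_comm])
    have e1 := cocyc x (v x) w (c x) (hv x) hx hcx
    have e2 := cocyc y w (c x) (v y) hy hcy (hv y)
    change σ.1 (v x) (c x) + σ.1 (c x) (v y) = _
    linear_combination e2 - e1
  rcases isEmpty_or_nonempty s with hemp | ⟨⟨x₀⟩⟩
  · refine ⟨0, eq_delta0_iff.mpr fun a b hab => ?_⟩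
    have h0 : Nonempty (Realization D) := by
      refine ⟨⟨Pi.single a 1, fun w => ?_, by simp, _, hab.2, fun w hw => ?_⟩⟩
      · by_cases h : w = a
        · subst h; simp
        · simp [h]
      · by_cases h : w = a
        · simp [h]
        · simp [h] at hw
    exact (hemp.false (φ h0.some)).elim
  -- With radius `ε / 2`, the points `y` and `z` are also within `ε` of each other, so all three
  -- values of `ω` can be computed through `c x`.
  obtain ⟨F, d, hd, hF⟩ := exists_primitive_of_local_cocycle hs hc.isBounded x₀ ω
    (half_pos hε) (fun x y z hxy hxz => by
      have hx : (φ.symm x).1 (c x) ≠ 0 := hcc x (Metric.mem_ball_self hε)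
      have hy : (φ.symm y).1 (c x) ≠ 0 := hcc x (by rw [Metric.mem_ball, dist_comm]; linarith)
      have hz : (φ.symm z).1 (c x) ≠ 0 := hcc x (by rw [Metric.mem_ball, dist_comm]; linarith)
      have hyz : dist y z < ε := (dist_triangle_left y z x).trans_lt (by linarith)
      rw [hω x y (c x) (by linarith) hx hy, hω x z (c x) (by linarith) hx hz,
        hω y z (c x) hyz hy hz, σ.2.1 (c x) (v y)]
      ring)
  let pt : W → Realization D := fun a => ⟨Pi.single a 1, fun w => by
      by_cases h : w = a
      · subst h; simp
      · simp [h], by simp, {a}, D.singleton_mem a, fun w hw => by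
      by_contra h
      rw [Finset.mem_singleton] at h
      simp [h] at hw⟩
  have hpt : ∀ a, v (φ (pt a)) = a := by
    intro a
    have h := hv (φ (pt a))
    rw [φ.symm_apply_apply] at h
    by_contra hne
    exact h (by simp [pt, hne])
  refine ⟨fun a => F (φ (pt a)), eq_delta0_iff.mpr fun a b hab => ?_⟩
  let q : unitInterval → Realization D := fun t =>
    ⟨fun w => (1 - t.1) * (pt a).1 w + t.1 * (pt b).1 w, fun w =>
      add_nonneg (mul_nonneg (sub_nonneg.mpr t.2.2) ((pt a).2.1 w))
        (mul_nonneg t.2.1 ((pt b).2.1 w)),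
      by rw [Finset.sum_add_distrib, ← Finset.mul_sum, ← Finset.mul_sum, (pt a).2.2.1,
          (pt b).2.2.1]; ring,
      _, hab.2, fun w hw => by
        by_contra h
        simp only [Finset.mem_insert, Finset.mem_singleton, not_or] at h
        simp [pt, h.1, h.2] at hw⟩
  have hqc : Continuous q := by
    refine Continuous.subtype_mk (continuous_pi fun w => ?_) _
    fun_prop
  have hqsupp : ∀ t w, (φ.symm (φ (q t))).1 w ≠ 0 → w ∈ ({a, b} : Finset W) := by
    intro t w hw
    rw [φ.symm_apply_apply] at hw
    by_contra h
    simp only [Finset.mem_insert, Finset.mem_singleton, not_or] at h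
    simp [q, pt, h.1, h.2] at hw
  have ha : a ∈ ({a, b} : Finset W) := by simp
  -- Along the edge all supports lie in `{a, b}`, where `σ` is additive, so `F` changes exactly as
  -- `σ.1 a` of the chosen vertex does. Connectedness of the interval then compares the two ends.
  have hlc : IsLocallyConstant fun t => F (φ (q t)) - σ.1 a (v (φ (q t))) := by
    rw [IsLocallyConstant.iff_eventually_eq]
    intro t
    have hball : ∀ᶠ t' in nhds t, φ (q t') ∈ Metric.ball (φ (q t)) (min d ε) :=
      (φ.continuous.comp hqc).continuousAt.eventually (Metric.ball_mem_nhds _ (lt_min hd hε))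
    filter_upwards [hball] with t' ht'
    rw [Metric.mem_ball, dist_comm, lt_min_iff] at ht'
    have h1 := hF _ _ ht'.1
    have hw := hcc (φ (q t)) (Metric.mem_ball_self hε)
    have e1 := cocycle_of_mem_faces hσ hab.2 (hqsupp t _ (hv _)) (hqsupp t _ hw)
      (hqsupp t' _ (hv _))
    have e2 := cocycle_of_mem_faces hσ hab.2 ha (hqsupp t _ (hv _)) (hqsupp t' _ (hv _))
    change _ = σ.1 (v (φ (q t))) (c (φ (q t))) + σ.1 (c (φ (q t))) (v (φ (q t'))) at h1
    linear_combination h1 + e1 + e2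
  have h01 := hlc.apply_eq_of_preconnectedSpace 0 1
  have hq0 : q 0 = pt a := Subtype.ext (by funext w; simp [q])
  have hq1 : q 1 = pt b := Subtype.ext (by funext w; simp [q])
  simp only [hq0, hq1, hpt, apply_self] at h01
  linear_combination h01

end CombSurface

namespace CombSurface

/-! ### Lifting simplices and cochains to the polygon -/

namespace CanonicalPolygon

variable {V W : Type*} [Fintype V] [DecidableEq V] [Fintype W] [DecidableEq W]
  {K : AbstractSimplicialComplex V} {o : SurfaceOrientation K} {g : ℕ} [NeZero g]
  {D : AbstractSimplicialComplex W}

theorem isEdge_proj (P : CanonicalPolygon K o g D) {u v : W} (h : IsEdge D u v) :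
    IsEdge K (P.proj u) (P.proj v) := by
  refine ⟨fun he => h.1 (P.proj_injOn _ h.2 (by simp) (by simp) he), ?_⟩
  simpa [Finset.image_insert] using P.proj_mem _ h.2

theorem isTriangle_proj (P : CanonicalPolygon K o g D) {u v w : W} (h : IsTriangle D u v w) :
    IsTriangle K (P.proj u) (P.proj v) (P.proj w) := by
  refine ⟨fun he => h.1 (P.proj_injOn _ h.2.2.2 (by simp) (by simp) he),
    fun he => h.2.1 (P.proj_injOn _ h.2.2.2 (by simp) (by simp) he),
    fun he => h.2.2.1 (P.proj_injOn _ h.2.2.2 (by simp) (by simp) he), ?_⟩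
  simpa [Finset.image_insert] using P.proj_mem _ h.2.2.2

theorem exists_isEdge_lift (P : CanonicalPolygon K o g D) {a b : V} (h : IsEdge K a b) :
    ∃ u v, IsEdge D u v ∧ P.proj u = a ∧ P.proj v = b := by
  obtain ⟨s, hs, hst⟩ := P.proj_surj _ h.2
  obtain ⟨u, hu, rfl⟩ := Finset.mem_image.mp (hst ▸ (by simp : a ∈ ({a, b} : Finset V)))
  obtain ⟨v, hv, rfl⟩ := Finset.mem_image.mp (hst ▸ (by simp : b ∈ ({P.proj u, b} : Finset V)))
  refine ⟨u, v, ⟨fun he => h.1 (by rw [he]), mem_faces_of_subset hs ?_ ⟨u, by simp⟩⟩, rfl, rfl⟩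
  intro x hx
  simp only [Finset.mem_insert, Finset.mem_singleton] at hx
  rcases hx with rfl | rfl <;> assumption

theorem exists_isTriangle_lift (P : CanonicalPolygon K o g D) {a b c : V}
    (h : IsTriangle K a b c) :
    ∃ u v w, IsTriangle D u v w ∧ P.proj u = a ∧ P.proj v = b ∧ P.proj w = c := by
  obtain ⟨s, hs, hst⟩ := P.proj_surj _ h.2.2.2
  obtain ⟨u, hu, rfl⟩ := Finset.mem_image.mp (hst ▸ (by simp : a ∈ ({a, b, c} : Finset V)))
  obtain ⟨v, hv, rfl⟩ :=
    Finset.mem_image.mp (hst ▸ (by simp : b ∈ ({P.proj u, b, c} : Finset V)))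
  obtain ⟨w, hw, rfl⟩ :=
    Finset.mem_image.mp (hst ▸ (by simp : c ∈ ({P.proj u, P.proj v, c} : Finset V)))
  refine ⟨u, v, w, ⟨fun he => h.1 (by rw [he]), fun he => h.2.1 (by rw [he]),
    fun he => h.2.2.1 (by rw [he]), mem_faces_of_subset hs ?_ ⟨u, by simp⟩⟩, rfl, rfl, rfl⟩
  intro x hx
  simp only [Finset.mem_insert, Finset.mem_singleton] at hx
  rcases hx with rfl | rfl | rfl <;> assumption

theorem isTriangle_eq_of_proj_eq (P : CanonicalPolygon K o g D) {u v w u' v' w' : W}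
    (h : IsTriangle D u v w) (h' : IsTriangle D u' v' w') (hu : P.proj u = P.proj u')
    (hv : P.proj v = P.proj v') (hw : P.proj w = P.proj w') : u = u' ∧ v = v' ∧ w = w' := by
  have hs : ({u, v, w} : Finset W) = {u', v', w'} := by
    refine P.glue_triangle _ h.2.2.2 _ h'.2.2.2 ?_ ?_
    · exact Finset.card_eq_three.mpr ⟨u, v, w, h.1, h.2.1, h.2.2.1, rfl⟩
    · simp [Finset.image_insert, hu, hv, hw]
  have hinj := P.proj_injOn _ h.2.2.2
  refine ⟨hinj (by simp) ?_ hu, hinj (by simp) ?_ hv, hinj (by simp) ?_ hw⟩ <;>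
  · rw [hs]; simp

/-- Summation over the ordered triangles of `K` can be carried out over those of the polygon. -/
theorem sum_triangle_eq (P : CanonicalPolygon K o g D) (F : V → V → V → ℂ)
    (hF : ∀ u v w, ¬ IsTriangle K u v w → F u v w = 0) :
    ∑ u, ∑ v, ∑ w, F u v w = ∑ u, ∑ v, ∑ w,
      open Classical in if IsTriangle D u v w then F (P.proj u) (P.proj v) (P.proj w) else 0 := by
  classical
  have e1 : ∑ u, ∑ v, ∑ w, F u v w = ∑ x : V × V × V, F x.1 x.2.1 x.2.2 := by
    simp only [Fintype.sum_prod_type]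
  have e2 : (∑ u, ∑ v, ∑ w,
      if IsTriangle D u v w then F (P.proj u) (P.proj v) (P.proj w) else 0) =
      ∑ x : W × W × W, if IsTriangle D x.1 x.2.1 x.2.2 then
        F (P.proj x.1) (P.proj x.2.1) (P.proj x.2.2) else 0 := by
    simp only [Fintype.sum_prod_type]
  rw [e1, e2, ← Finset.sum_filter]
  symm
  refine Finset.sum_of_injOn (fun x => (P.proj x.1, P.proj x.2.1, P.proj x.2.2)) ?_ ?_ ?_ ?_
  · intro x hx y hy hxy
    simp only [Finset.coe_filter, Finset.mem_univ, true_and, Set.mem_ofPred_eq] at hx hy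
    simp only [Prod.mk.injEq] at hxy
    obtain ⟨h1, h2, h3⟩ := P.isTriangle_eq_of_proj_eq hx hy hxy.1 hxy.2.1 hxy.2.2
    exact Prod.ext h1 (Prod.ext h2 h3)
  · intro x _
    simp
  · intro x _ hx
    refine hF _ _ _ fun ht => hx ?_
    obtain ⟨u, v, w, h, hu, hv, hw⟩ := P.exists_isTriangle_lift ht
    exact ⟨(u, v, w), by simpa using h, by simp [hu, hv, hw]⟩
  · intro x _
    rfl

/-- `f` is a potential on the polygon of the cochain `σ` of the surface. -/
def IsPotential (P : CanonicalPolygon K o g D) (σ : Cochain1 K) (f : W → ℂ) : Prop :=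
  ∀ u v, IsEdge D u v → σ.1 (P.proj u) (P.proj v) = f v - f u

/-- The pullback of `σ` to the polygon is closed because triangles map to triangles, hence exact
because a closed ball is compact and convex. -/
theorem exists_isPotential (P : CanonicalPolygon K o g D) {σ : Cochain1 K}
    (hσ : delta1 K σ = 0) : ∃ f, P.IsPotential σ f := by
  classical
  let σ' : Cochain1 D :=
    ⟨fun u v => if IsEdge D u v then σ.1 (P.proj u) (P.proj v) else 0, by
      refine ⟨fun u v => ?_, fun u v h => if_neg h⟩
      by_cases h : IsEdge D u v
      · simp only [h, h.symm, if_true, σ.2.1 (P.proj u) (P.proj v)]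
      · have h' : ¬ IsEdge D v u := fun h' => h h'.symm
        simp [h, h']⟩
  have happ : ∀ u v, IsEdge D u v → σ'.1 u v = σ.1 (P.proj u) (P.proj v) :=
    fun u v h => if_pos h
  have hσ' : delta1 D σ' = 0 := by
    refine delta1_eq_zero_iff.mpr fun u v w h => ?_
    have huv : IsEdge D u v := ⟨h.1, mem_faces_of_subset h.2.2.2 (by grind) ⟨u, by simp⟩⟩
    have huw : IsEdge D u w := ⟨h.2.1, mem_faces_of_subset h.2.2.2 (by grind) ⟨u, by simp⟩⟩
    have hvw : IsEdge D v w := ⟨h.2.2.1, mem_faces_of_subset h.2.2.2 (by grind) ⟨v, by simp⟩⟩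
    rw [happ _ _ huv, happ _ _ huw, happ _ _ hvw]
    exact cocycle_of_isTriangle hσ (P.isTriangle_proj h)
  obtain ⟨φ⟩ := P.disc
  obtain ⟨f, hf⟩ := exists_eq_delta0_of_homeomorph_convex (convex_closedBall _ _)
    (isCompact_closedBall _ _) φ hσ'
  exact ⟨f, fun u v h => by rw [← happ u v h, eq_delta0_iff.mp hf u v h]⟩

/-! ### Jumps of a potential across paired sides -/

theorem proj_side_eq_proj_opp (P : CanonicalPolygon K o g D) {i : Fin g} {s : Fin 2} {k : ℕ}
    (hk : k ≤ P.len i s) : P.proj (P.side i s k) = P.proj (P.opp i s k) :=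
  (P.glue_vertex _ _).mpr (Relation.EqvGen.rel _ _ ⟨i, s, k, hk, rfl, rfl⟩)

/-- Paired edges have the same image in `K`, so `f` has equal increments along a side and its
opposite. -/
theorem IsPotential.jump {P : CanonicalPolygon K o g D} {σ : Cochain1 K} {f : W → ℂ}
    (hf : P.IsPotential σ f) (i : Fin g) (s : Fin 2) {k : ℕ} (hk : k ≤ P.len i s) :
    f (P.opp i s k) - f (P.side i s k) = f (P.opp i s 0) - f (P.side i s 0) := by
  induction k with
  | zero => rfl
  | succ k ih =>
    have e1 := hf _ _ (P.side_edge i s k hk)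
    have e2 := hf _ _ (P.opp_edge i s k hk)
    rw [← P.proj_side_eq_proj_opp hk, ← P.proj_side_eq_proj_opp (Nat.le_of_succ_le hk)] at e2
    linear_combination ih (Nat.le_of_succ_le hk) + e1 - e2

theorem IsPotential.period_eq {P : CanonicalPolygon K o g D} {σ : Cochain1 K} {f : W → ℂ}
    (hf : P.IsPotential σ f) (i : Fin g) (s : Fin 2) :
    P.period σ i s = f (P.side i s (P.len i s)) - f (P.side i s 0) := by
  rw [period, ← Finset.sum_range_sub (fun k => f (P.side i s k))]
  exact Finset.sum_congr rfl fun k hk => hf _ _ (P.side_edge i s k (Finset.mem_range.mp hk))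

/-- At the far corner of `a_i` the two paired points are the start and the end of `b_i`, so the jump
is the increment of `f` along `b_i`. -/
theorem IsPotential.jump_a {P : CanonicalPolygon K o g D} {σ : Cochain1 K} {f : W → ℂ}
    (hf : P.IsPotential σ f) (i : Fin g) {k : ℕ} (hk : k ≤ P.len i 0) :
    f (P.opp i 0 k) - f (P.side i 0 k) = P.periodB σ i := by
  rw [periodB, hf.period_eq, hf.jump i 0 hk, ← hf.jump i 0 le_rfl, P.corner_a_b, P.corner_b_a']

/-- At the far corner of `b_i` the paired points are the two ends of `a_i⁻¹`, reached against the
direction of `a_i`; hence the sign. -/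
theorem IsPotential.jump_b {P : CanonicalPolygon K o g D} {σ : Cochain1 K} {f : W → ℂ}
    (hf : P.IsPotential σ f) (i : Fin g) {k : ℕ} (hk : k ≤ P.len i 1) :
    f (P.opp i 1 k) - f (P.side i 1 k) = - P.periodA σ i := by
  have h1 := hf.jump_a i le_rfl
  have h2 := hf.jump_a i (Nat.zero_le _)
  rw [periodA, hf.period_eq, hf.jump i 1 hk, ← hf.jump i 1 le_rfl, ← P.corner_a'_b',
    P.corner_b_a']
  linear_combination h2 - h1

end CanonicalPolygon

/-! ### The bilinear relation for closed cochains -/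

/-- Discrete Stokes. Over ordered triples, each of the three faces contributes the same sum, hence
the factor `3`. -/
theorem sum_alternating_mul {W : Type*} [Fintype W] (c : W → W → W → ℂ) (h : W → W → ℂ)
    (h1 : ∀ u v w, c v u w = - c u v w) (h2 : ∀ u v w, c u w v = - c u v w) :
    ∑ u, ∑ v, ∑ w, c u v w * (h u v + h v w - h u w) = 3 * ∑ u, ∑ v, h u v * ∑ w, c u v w := by
  have e1 : ∑ u, ∑ v, ∑ w, c u v w * h u v = ∑ u, ∑ v, h u v * ∑ w, c u v w := by
    simp only [Finset.mul_sum, mul_comm]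
  have e2 : ∑ u, ∑ v, ∑ w, c u v w * h v w = ∑ u, ∑ v, ∑ w, c u v w * h u v := by
    rw [Finset.sum_comm]
    refine Finset.sum_congr rfl fun u _ => ?_
    rw [Finset.sum_comm]
    refine Finset.sum_congr rfl fun v _ => Finset.sum_congr rfl fun w _ => ?_
    rw [h1 u w v, h2 u v w, neg_neg]
  have e3 : ∑ u, ∑ v, ∑ w, c u v w * h u w = - ∑ u, ∑ v, ∑ w, c u v w * h u v := by
    simp only [← Finset.sum_neg_distrib]
    refine Finset.sum_congr rfl fun u _ => ?_
    rw [Finset.sum_comm]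
    refine Finset.sum_congr rfl fun v _ => Finset.sum_congr rfl fun w _ => ?_
    rw [h2 u v w, neg_mul]
  simp only [mul_sub, mul_add, Finset.sum_sub_distrib, Finset.sum_add_distrib, e2, e3, e1]
  ring

variable {V W : Type*} [Fintype V] [DecidableEq V] [Fintype W] [DecidableEq W]
  {K : AbstractSimplicialComplex V} {o : SurfaceOrientation K} {g : ℕ} [NeZero g]
  {D : AbstractSimplicialComplex W}

/-- Riemann's bilinear relation for closed cochains. -/
theorem CanonicalPolygon.evalFund_cup (P : CanonicalPolygon K o g D) {σ τ : Cochain1 K}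
    (hσ : delta1 K σ = 0) (hτ : delta1 K τ = 0) :
    evalFund o (cup σ τ) =
      ∑ i, (P.periodA σ i * P.periodB τ i - P.periodB σ i * P.periodA τ i) := by
  classical
  obtain ⟨f, hf⟩ := P.exists_isPotential hσ
  let t : W → W → ℂ := fun u v => τ.1 (P.proj u) (P.proj v)
  have ht : ∀ u v, t v u = - t u v := fun u v => τ.2.1 _ _
  -- Heuristically `Wσ ∧ Wτ = d(f · Wτ)`. On an edge `Wτ` is constant and `f` linear, so the
  -- integral of `f · Wτ` is the mean of `f` at the ends times `τ`.
  let h : W → W → ℂ := fun u v => (f u + f v) / 2 * t u v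
  have hh : ∀ u v, h v u = - h u v := fun u v => by
    change (f v + f u) / 2 * t v u = - ((f u + f v) / 2 * t u v)
    rw [ht u v]; ring
  -- The fundamental chain lifted to the polygon; its boundary is given by `P.oriented`.
  let c : W → W → W → ℤ := fun u v w =>
    if IsTriangle D u v w then o.coeff (P.proj u) (P.proj v) (P.proj w) else 0
  have hc1 : ∀ u v w, c v u w = - c u v w := by
    intro u v w
    by_cases hT : IsTriangle D u v w
    · simp only [c, hT, hT.swap_left, if_true, o.swap_left (P.proj u)]
    · have hT' : ¬ IsTriangle D v u w := fun h' => hT h'.swap_left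
      simp [c, hT, hT']
  have hc2 : ∀ u v w, c u w v = - c u v w := by
    intro u v w
    by_cases hT : IsTriangle D u v w
    · simp only [c, hT, hT.swap_right, if_true, o.swap_right (P.proj u) (P.proj v)]
    · have hT' : ¬ IsTriangle D u w v := fun h' => hT h'.swap_right
      simp [c, hT, hT']
  have hlift : ∑ u, ∑ v, ∑ w, (o.coeff u v w : ℂ) * (cup σ τ).1 u v w =
      ∑ u, ∑ v, ∑ w, (c u v w : ℂ) * (h u v + h v w - h u w) := by
    rw [P.sum_triangle_eq _ fun u v w hT => by rw [(cup σ τ).2.2.2 u v w hT, mul_zero]]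
    refine Finset.sum_congr rfl fun u _ => Finset.sum_congr rfl fun v _ =>
      Finset.sum_congr rfl fun w _ => ?_
    by_cases hT : IsTriangle D u v w
    · have hK := P.isTriangle_proj hT
      have huv : IsEdge D u v := ⟨hT.1, mem_faces_of_subset hT.2.2.2 (by grind) ⟨u, by simp⟩⟩
      have huw : IsEdge D u w := ⟨hT.2.1, mem_faces_of_subset hT.2.2.2 (by grind) ⟨u, by simp⟩⟩
      have hvw : IsEdge D v w :=
        ⟨hT.2.2.1, mem_faces_of_subset hT.2.2.2 (by grind) ⟨v, by simp⟩⟩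
      have e : t u w = t u v + t v w := (cocycle_of_isTriangle hτ hK).symm
      simp only [hT, if_true, c, cup, hK, whitneyIntegral_eq, hf u v huv, hf u w huw, hf v w hvw]
      change _ * (1 / 6 * ((f v - f u) * t v w - (f w - f v) * t u v +
        ((f v - f u) * t u w - (f w - f u) * t u v) +
        ((f w - f u) * t v w - (f w - f v) * t u w))) = _ * ((f u + f v) / 2 * t u v +
        (f v + f w) / 2 * t v w - (f u + f w) / 2 * t u w)
      rw [e]
      ring
    · simp [hT, c]
  -- The factor `2` comes from the two orders of each boundary edge, `h` being antisymmetric.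
  -- Together with the `3` of Stokes it cancels the `1 / 6` of `evalFund`.
  have hbd : ∑ u, ∑ v, h u v * ∑ w, (c u v w : ℂ) = ∑ i, ∑ s, ∑ k ∈ Finset.range (P.len i s),
      2 * (h (P.side i s k) (P.side i s (k + 1)) - h (P.opp i s k) (P.opp i s (k + 1))) := by
    have ind : ∀ a b : W, ∑ u, ∑ v, h u v * (if (u, v) = (a, b) then (1 : ℂ) else 0) = h a b := by
      intro a b
      simp [Prod.mk.injEq, ite_and]
    have ind' : ∀ a b : W,
        ∑ u, ∑ v, h u v * (if (v, u) = (a, b) then (1 : ℂ) else 0) = - h a b := by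
      intro a b
      rw [Finset.sum_comm, ← hh a b, ← ind b a, Finset.sum_comm]
      refine Finset.sum_congr rfl fun u _ => Finset.sum_congr rfl fun v _ => ?_
      simp only [Prod.mk.injEq, and_comm]
    have e : ∀ u v, ∑ w, (c u v w : ℂ) = ((∑ w, c u v w : ℤ) : ℂ) := fun u v => by push_cast; rfl
    have e' : ∀ u v, ∑ w, c u v w = _ := P.oriented
    simp only [e, e']
    push_cast
    simp only [Finset.mul_sum]
    have sw : ∀ G : W → W → (i : Fin g) → Fin 2 → ℕ → ℂ,
        ∑ u, ∑ v, ∑ i, ∑ s, ∑ k ∈ Finset.range (P.len i s), G u v i s k =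
        ∑ i, ∑ s, ∑ k ∈ Finset.range (P.len i s), ∑ u, ∑ v, G u v i s k := by
      intro G
      calc _ = ∑ u, ∑ i, ∑ s, ∑ k ∈ Finset.range (P.len i s), ∑ v, G u v i s k := by
            refine Finset.sum_congr rfl fun u _ => ?_
            rw [Finset.sum_comm]
            refine Finset.sum_congr rfl fun i _ => ?_
            rw [Finset.sum_comm]
            exact Finset.sum_congr rfl fun s _ => Finset.sum_comm
        _ = _ := by
            rw [Finset.sum_comm]
            refine Finset.sum_congr rfl fun i _ => ?_
            rw [Finset.sum_comm]
            exact Finset.sum_congr rfl fun s _ => Finset.sum_comm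
    rw [sw]
    refine Finset.sum_congr rfl fun i _ => Finset.sum_congr rfl fun s _ =>
      Finset.sum_congr rfl fun k _ => ?_
    simp only [mul_add, mul_sub, Finset.sum_add_distrib, Finset.sum_sub_distrib, ind, ind']
    ring
  rw [evalFund, hlift, sum_alternating_mul (fun u v w => (c u v w : ℂ)) h
    (fun u v w => by rw [hc1]; push_cast; rfl) (fun u v w => by rw [hc2]; push_cast; rfl), hbd]
  rw [Finset.mul_sum, Finset.mul_sum]
  refine Finset.sum_congr rfl fun i _ => ?_
  -- With `τ` equal on paired edges and jump `j` at both endpoints, the difference of the means of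
  -- `f` is `-j`.
  have hs : ∀ (s : Fin 2) (j : ℂ),
      (∀ k ≤ P.len i s, f (P.opp i s k) - f (P.side i s k) = j) →
      ∑ k ∈ Finset.range (P.len i s), 2 * (h (P.side i s k) (P.side i s (k + 1)) -
        h (P.opp i s k) (P.opp i s (k + 1))) = - (2 * j * P.period τ i s) := by
    intro s j hj
    rw [CanonicalPolygon.period, Finset.mul_sum, ← Finset.sum_neg_distrib]
    refine Finset.sum_congr rfl fun k hk => ?_
    have hk' := Finset.mem_range.mp hk
    have e : t (P.opp i s k) (P.opp i s (k + 1)) = t (P.side i s k) (P.side i s (k + 1)) := by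
      change τ.1 _ _ = τ.1 _ _
      rw [P.proj_side_eq_proj_opp hk', P.proj_side_eq_proj_opp (Nat.le_of_lt hk')]
    change 2 * ((f (P.side i s k) + f (P.side i s (k + 1))) / 2 *
      t (P.side i s k) (P.side i s (k + 1)) - (f (P.opp i s k) + f (P.opp i s (k + 1))) / 2 *
      t (P.opp i s k) (P.opp i s (k + 1))) = - (2 * j * t (P.side i s k) (P.side i s (k + 1)))
    rw [e]
    linear_combination (-t (P.side i s k) (P.side i s (k + 1))) *
      (hj k hk'.le + hj (k + 1) hk')
  rw [Fin.sum_univ_two, hs 0 _ fun k hk => hf.jump_a i hk, hs 1 _ fun k hk => hf.jump_b i hk]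
  simp only [CanonicalPolygon.periodA, CanonicalPolygon.periodB]
  ring

end CombSurface

namespace CombSurface

/-! ### Periods classify closed cochains modulo exact ones -/

namespace CanonicalPolygon

variable {V W : Type*} [Fintype V] [DecidableEq V] [Fintype W] [DecidableEq W]
  {K : AbstractSimplicialComplex V} {o : SurfaceOrientation K} {g : ℕ} [NeZero g]
  {D : AbstractSimplicialComplex W}

/-- The half-open sides, `k < len` on `side` and `k + 1` on `opp`, list each boundary vertex once,
so values on them can be prescribed freely. -/
theorem exists_boundary_values (P : CanonicalPolygon K o g D) (S O : Fin g → Fin 2 → ℕ → ℂ) :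
    ∃ f : W → ℂ, (∀ i s k, k < P.len i s → f (P.side i s k) = S i s k) ∧
      ∀ i s k, k < P.len i s → f (P.opp i s (k + 1)) = O i s k := by
  classical
  refine ⟨fun w => if h : ∃ x : Fin g × Fin 2 × ℕ, x.2.2 < P.len x.1 x.2.1 ∧
      P.side x.1 x.2.1 x.2.2 = w then S h.choose.1 h.choose.2.1 h.choose.2.2
    else if h : ∃ x : Fin g × Fin 2 × ℕ, x.2.2 < P.len x.1 x.2.1 ∧
      P.opp x.1 x.2.1 (x.2.2 + 1) = w then O h.choose.1 h.choose.2.1 h.choose.2.2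
    else 0, fun i s k hk => ?_, fun i s k hk => ?_⟩
  · have h : ∃ x : Fin g × Fin 2 × ℕ, x.2.2 < P.len x.1 x.2.1 ∧
        P.side x.1 x.2.1 x.2.2 = P.side i s k := ⟨(i, s, k), hk, rfl⟩
    obtain ⟨h1, h2, h3⟩ := P.side_inj _ _ _ _ _ _ h.choose_spec.1 hk h.choose_spec.2
    simp only [dif_pos h]
    rw [h1, h2, h3]
  · have h0 : ¬ ∃ x : Fin g × Fin 2 × ℕ, x.2.2 < P.len x.1 x.2.1 ∧
        P.side x.1 x.2.1 x.2.2 = P.opp i s (k + 1) :=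
      fun ⟨x, hx, he⟩ => P.side_ne_opp _ _ _ _ _ _ hx hk he
    have h : ∃ x : Fin g × Fin 2 × ℕ, x.2.2 < P.len x.1 x.2.1 ∧
        P.opp x.1 x.2.1 (x.2.2 + 1) = P.opp i s (k + 1) := ⟨(i, s, k), hk, rfl⟩
    obtain ⟨h1, h2, h3⟩ := P.opp_inj _ _ _ _ _ _ h.choose_spec.1 hk h.choose_spec.2
    simp only [dif_neg h0, dif_pos h]
    rw [h1, h2, h3]

/-- There is a function on the polygon with prescribed jumps across the side pairings. -/
theorem exists_jumps (P : CanonicalPolygon K o g D) (A B : Fin g → ℂ) :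
    ∃ f : W → ℂ, ∀ i k, (k ≤ P.len i 0 → f (P.opp i 0 k) - f (P.side i 0 k) = B i) ∧
      (k ≤ P.len i 1 → f (P.opp i 1 k) - f (P.side i 1 k) = - A i) := by
  -- Going round each block of four sides, the corner values are `0, A, A + B, B, 0`. The
  -- exceptional values at `k + 1 = len` are corners shared with the preceding side.
  obtain ⟨f, hS, hO⟩ := P.exists_boundary_values (fun i s _ => if s = 0 then 0 else A i)
    (fun i s k => if s = 0 then B i + (if k + 1 = P.len i 0 then A i else 0)
      else if k + 1 = P.len i 1 then B i else 0)
  have hS0 : ∀ i k, k < P.len i 0 → f (P.side i 0 k) = 0 := fun i k hk => by simpa using hS i 0 k hk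
  have hS1 : ∀ i k, k < P.len i 1 → f (P.side i 1 k) = A i := fun i k hk => by
    simpa using hS i 1 k hk
  have hO0 : ∀ i k, k < P.len i 0 → f (P.opp i 0 (k + 1)) =
      B i + (if k + 1 = P.len i 0 then A i else 0) := fun i k hk => by simpa using hO i 0 k hk
  have hO1 : ∀ i k, k < P.len i 1 → f (P.opp i 1 (k + 1)) =
      if k + 1 = P.len i 1 then B i else 0 := fun i k hk => by simpa using hO i 1 k hk
  have hl : ∀ i s, P.len i s - 1 + 1 = P.len i s := fun i s => Nat.sub_add_cancel (P.len_pos i s)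
  have hO0l : ∀ i, f (P.opp i 0 (P.len i 0)) = B i + A i := fun i => by
    have h := hO0 i (P.len i 0 - 1) (Nat.sub_lt (P.len_pos i 0) one_pos)
    rwa [hl, if_pos rfl] at h
  have hO1l : ∀ i, f (P.opp i 1 (P.len i 1)) = B i := fun i => by
    have h := hO1 i (P.len i 1 - 1) (Nat.sub_lt (P.len_pos i 1) one_pos)
    rwa [hl, if_pos rfl] at h
  refine ⟨f, fun i k => ⟨fun hk => ?_, fun hk => ?_⟩⟩
  · rcases hk.eq_or_lt with rfl | hk'
    · rw [hO0l, P.corner_a_b, hS1 i 0 (P.len_pos i 1)]; ring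
    · rw [hS0 i k hk']
      cases k with
      | zero => rw [P.corner_a'_b', hO1l, sub_zero]
      | succ m => rw [hO0 i m (by omega), if_neg hk'.ne]; ring
  · rcases hk.eq_or_lt with rfl | hk'
    · rw [hO1l, P.corner_b_a', hO0l]; ring
    · rw [hS1 i k hk']
      cases k with
      | zero => rw [P.corner_b'_a, hS0 _ 0 (P.len_pos _ 0), zero_sub]
      | succ m => rw [hO1 i m (by omega), if_neg hk'.ne, zero_sub]

/-- A function on the polygon with constant jumps across the side pairings is the potential of a
closed cochain of the surface. -/
theorem exists_closed_of_jumps (P : CanonicalPolygon K o g D) {f : W → ℂ}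
    {c : Fin g → Fin 2 → ℂ}
    (hf : ∀ i s k, k ≤ P.len i s → f (P.opp i s k) - f (P.side i s k) = c i s) :
    ∃ τ : Cochain1 K, delta1 K τ = 0 ∧ P.IsPotential τ f := by
  classical
  have pair : ∀ (i : Fin g) (s : Fin 2) (k : ℕ), k < P.len i s → ∀ u v u' v', IsEdge D u v →
      P.proj u = P.proj u' → P.proj v = P.proj v' →
      ({u, v} : Finset W) = {P.side i s k, P.side i s (k + 1)} →
      ({u', v'} : Finset W) = {P.opp i s k, P.opp i s (k + 1)} → f v - f u = f v' - f u' := by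
    intro i s k hk u v u' v' he hu hv h1 h2
    have j0 := hf i s k hk.le
    have j1 := hf i s (k + 1) hk
    have p0 := P.proj_side_eq_proj_opp (i := i) (s := s) hk.le
    have p1 := P.proj_side_eq_proj_opp (i := i) (s := s) (k := k + 1) hk
    have hne := (P.isEdge_proj he).1
    rw [← Finset.coe_inj, Finset.coe_pair, Finset.coe_pair, Set.pair_eq_pair_iff] at h1 h2
    -- The two order-reversing matches would give `u` and `v` the same image, collapsing an edge.
    rcases h1 with ⟨rfl, rfl⟩ | ⟨rfl, rfl⟩ <;> rcases h2 with ⟨rfl, rfl⟩ | ⟨rfl, rfl⟩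
    · linear_combination j0 - j1
    · exact absurd (hu.trans p1.symm) hne
    · exact absurd (hu.trans p0.symm) hne
    · linear_combination j1 - j0
  have wd : ∀ u v u' v', IsEdge D u v → IsEdge D u' v' → P.proj u = P.proj u' →
      P.proj v = P.proj v' → f v - f u = f v' - f u' := by
    intro u v u' v' he he' hu hv
    rcases P.glue_edge u v u' v' he he' hu hv with ⟨rfl, rfl⟩ | ⟨i, s, k, hk, ⟨h1, h2⟩ | ⟨h1, h2⟩⟩
    · rfl
    · exact pair i s k hk u v u' v' he hu hv h1 h2
    · exact (pair i s k hk u' v' u v he' hu.symm hv.symm h2 h1).symm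
  have hex : ∀ a b, ∃ z : ℂ, (¬ IsEdge K a b → z = 0) ∧
      ∀ u v, IsEdge D u v → P.proj u = a → P.proj v = b → z = f v - f u := by
    intro a b
    by_cases h : IsEdge K a b
    · obtain ⟨u, v, he, rfl, rfl⟩ := P.exists_isEdge_lift h
      exact ⟨f v - f u, fun h' => absurd h h',
        fun u' v' he' hu hv => wd u v u' v' he he' hu.symm hv.symm⟩
    · refine ⟨0, fun _ => rfl, ?_⟩
      rintro u v he rfl rfl
      exact absurd (P.isEdge_proj he) h
  choose τ hτ0 hτ using hex
  let τ' : Cochain1 K := ⟨τ, fun a b => by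
    by_cases h : IsEdge K a b
    · obtain ⟨u, v, he, rfl, rfl⟩ := P.exists_isEdge_lift h
      rw [hτ _ _ u v he rfl rfl, hτ _ _ v u he.symm rfl rfl]; ring
    · rw [hτ0 a b h, hτ0 b a fun h' => h h'.symm, neg_zero], hτ0⟩
  refine ⟨τ', delta1_eq_zero_iff.mpr fun a b d h => ?_, fun u v he => hτ _ _ u v he rfl rfl⟩
  obtain ⟨u, v, w, hT, rfl, rfl, rfl⟩ := P.exists_isTriangle_lift h
  have huv : IsEdge D u v := ⟨hT.1, mem_faces_of_subset hT.2.2.2 (by grind) ⟨u, by simp⟩⟩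
  have huw : IsEdge D u w := ⟨hT.2.1, mem_faces_of_subset hT.2.2.2 (by grind) ⟨u, by simp⟩⟩
  have hvw : IsEdge D v w := ⟨hT.2.2.1, mem_faces_of_subset hT.2.2.2 (by grind) ⟨v, by simp⟩⟩
  change τ _ _ + τ _ _ = τ _ _
  rw [hτ _ _ u v huv rfl rfl, hτ _ _ u w huw rfl rfl, hτ _ _ v w hvw rfl rfl]
  ring

/-- Closed cochains have arbitrary periods. -/
theorem exists_closed_of_periods (P : CanonicalPolygon K o g D) (A B : Fin g → ℂ) :
    ∃ τ : Cochain1 K, delta1 K τ = 0 ∧ ∀ i, P.periodA τ i = A i ∧ P.periodB τ i = B i := by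
  obtain ⟨f, hf⟩ := P.exists_jumps A B
  obtain ⟨τ, hτ, hfτ⟩ := P.exists_closed_of_jumps (f := f) (c := fun i s => ![B i, - A i] s)
    (fun i s k hk => by
      fin_cases s
      · exact (hf i k).1 hk
      · exact (hf i k).2 hk)
  refine ⟨τ, hτ, fun i => ⟨?_, ?_⟩⟩
  · rw [← neg_inj, ← hfτ.jump_b i (Nat.zero_le _), (hf i 0).2 (Nat.zero_le _)]
  · rw [← hfτ.jump_a i (Nat.zero_le _), (hf i 0).1 (Nat.zero_le _)]

/-- A closed cochain whose periods vanish is exact. -/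
theorem exists_eq_delta0_of_period_eq_zero (P : CanonicalPolygon K o g D) {σ : Cochain1 K}
    (hσ : delta1 K σ = 0) (hA : ∀ i, P.periodA σ i = 0) (hB : ∀ i, P.periodB σ i = 0) :
    ∃ f : V → ℂ, σ = delta0 K f := by
  obtain ⟨f, hf⟩ := P.exists_isPotential hσ
  -- Zero periods mean zero jumps, so the potential is constant on the fibres of `proj` and descends
  -- to `K`.
  have hglue : ∀ w w', P.proj w = P.proj w' → f w = f w' := by
    intro w w' h
    rw [P.glue_vertex] at h
    induction h with
    | rel x y h =>
      obtain ⟨i, s, k, hk, rfl, rfl⟩ := h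
      fin_cases s
      · have := hf.jump_a i hk
        rw [hB] at this
        exact (sub_eq_zero.mp this).symm
      · have := hf.jump_b i hk
        rw [hA, neg_zero] at this
        exact (sub_eq_zero.mp this).symm
    | refl x => rfl
    | symm x y _ ih => exact ih.symm
    | trans x y z _ _ ih1 ih2 => exact ih1.trans ih2
  have hex : ∀ a, ∃ z : ℂ, ∀ w, P.proj w = a → f w = z := by
    intro a
    by_cases h : ∃ w, P.proj w = a
    · obtain ⟨w, rfl⟩ := h
      exact ⟨f w, fun w' h => hglue w' w h⟩
    · exact ⟨0, fun w hw => absurd ⟨w, hw⟩ h⟩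
  choose F hF using hex
  refine ⟨F, eq_delta0_iff.mpr fun a b h => ?_⟩
  obtain ⟨u, v, he, rfl, rfl⟩ := P.exists_isEdge_lift h
  rw [hf u v he, hF _ u rfl, hF _ v rfl]

/-! ### Periods of exact cochains, linearity and conjugation -/

theorem periodA_delta0 (P : CanonicalPolygon K o g D) (F : V → ℂ) (i : Fin g) :
    P.periodA (delta0 K F) i = 0 := by
  have h : P.IsPotential (delta0 K F) (F ∘ P.proj) := fun u v he =>
    delta0_apply_of_isEdge F (P.isEdge_proj he)
  have h0 := h.jump_b i (Nat.zero_le _)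
  simpa [P.proj_side_eq_proj_opp (Nat.zero_le (P.len i 1))] using h0.symm

theorem periodB_delta0 (P : CanonicalPolygon K o g D) (F : V → ℂ) (i : Fin g) :
    P.periodB (delta0 K F) i = 0 := by
  have h : P.IsPotential (delta0 K F) (F ∘ P.proj) := fun u v he =>
    delta0_apply_of_isEdge F (P.isEdge_proj he)
  have h0 := h.jump_a i (Nat.zero_le _)
  simpa [P.proj_side_eq_proj_opp (Nat.zero_le (P.len i 0))] using h0.symm

theorem period_add (P : CanonicalPolygon K o g D) (σ τ : Cochain1 K) (i : Fin g) (s : Fin 2) :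
    P.period (σ + τ) i s = P.period σ i s + P.period τ i s := by
  simp [period, Finset.sum_add_distrib]

theorem period_smul (P : CanonicalPolygon K o g D) (z : ℂ) (σ : Cochain1 K) (i : Fin g)
    (s : Fin 2) : P.period (z • σ) i s = z * P.period σ i s := by
  simp [period, Finset.mul_sum]

theorem period_conjCochain (P : CanonicalPolygon K o g D) (σ : Cochain1 K) (i : Fin g)
    (s : Fin 2) : P.period (conjCochain σ) i s = conj (P.period σ i s) := by
  simp [period, conjCochain]

end CanonicalPolygon

end CombSurface

namespace CombSurface

/-! ### The star operator on harmonic cochains -/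

theorem exists_orthogonal_decomposition {E : Type*} [AddCommGroup E] [Module ℂ E]
    [FiniteDimensional ℂ E] (ip : InnerProductSpace.Core ℂ E) (S : Submodule ℂ E) (x : E) :
    ∃ y ∈ S, ∃ z, (∀ u ∈ S, ip.inner u z = 0) ∧ x = y + z := by
  let _ : NormedAddCommGroup E := ip.toNormedAddCommGroup
  let _ : InnerProductSpace ℂ E := InnerProductSpace.ofCore ip.toCore
  obtain ⟨y, hy, z, hz, h⟩ := S.exists_add_mem_mem_orthogonal x
  exact ⟨y, hy, z, fun u hu => (Submodule.mem_orthogonal S z).mp hz u hu, h⟩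

section Herm

variable {V : Type*} [DecidableEq V] {K : AbstractSimplicialComplex V}

theorem conjCochain_conjCochain (σ : Cochain1 K) : conjCochain (conjCochain σ) = σ := by
  ext u v
  exact Complex.conj_conj _

theorem delta1_conjCochain {σ : Cochain1 K} (hσ : delta1 K σ = 0) :
    delta1 K (conjCochain σ) = 0 := by
  rw [delta1_eq_zero_iff] at hσ ⊢
  intro u v w h
  simp only [conjCochain, ← map_add, hσ u v w h]

theorem conjCochain_delta0 (f : V → ℂ) :
    conjCochain (delta0 K f) = delta0 K (fun v => conj (f v)) := by
  refine eq_delta0_iff.mpr fun u v h => ?_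
  rw [← map_sub, ← delta0_apply_of_isEdge f h]
  rfl

variable (ip : InnerProductSpace.Core ℂ (Cochain1 K))

theorem conj_herm (a b : Cochain1 K) : conj (herm ip a b) = herm ip b a :=
  ip.conj_inner_symm a b

theorem herm_add_right (a b c : Cochain1 K) : herm ip a (b + c) = herm ip a b + herm ip a c :=
  ip.add_left b c a

theorem herm_smul_right (z : ℂ) (a b : Cochain1 K) : herm ip a (z • b) = conj z * herm ip a b :=
  ip.smul_left b a z

theorem herm_smul_left (z : ℂ) (a b : Cochain1 K) : herm ip (z • a) b = z * herm ip a b := by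
  rw [← conj_herm, herm_smul_right, map_mul, Complex.conj_conj, conj_herm]

theorem eq_zero_of_herm_self {a : Cochain1 K} (h : herm ip a a = 0) : a = 0 :=
  ip.definite a h

theorem herm_self_eq_re (a : Cochain1 K) : herm ip a a = ((herm ip a a).re : ℂ) :=
  (Complex.conj_eq_iff_re.mp (conj_herm ip a a)).symm

theorem herm_self_re_nonneg (a : Cochain1 K) : 0 ≤ (herm ip a a).re :=
  ip.re_inner_nonneg a

theorem hermNorm_sq (a : Cochain1 K) : ((hermNorm ip a ^ 2 : ℝ) : ℂ) = herm ip a a := by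
  rw [hermNorm, Real.sq_sqrt (herm_self_re_nonneg ip a), ← herm_self_eq_re]

theorem herm_self_nonneg (a : Cochain1 K) : 0 ≤ herm ip a a := by
  rw [herm_self_eq_re]
  exact_mod_cast herm_self_re_nonneg ip a

/-- A closed cochain is the sum of an exact and a harmonic one. -/
theorem exists_harmonic_decomposition [Fintype V] {τ : Cochain1 K} (hτ : delta1 K τ = 0) :
    ∃ f : V → ℂ, ∃ h ∈ harmonic ip, τ = delta0 K f + h := by
  obtain ⟨y, ⟨f, rfl⟩, z, hz, h⟩ :=
    exists_orthogonal_decomposition ip (LinearMap.range (delta0 K)) τ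
  refine ⟨f, z, ⟨?_, fun f' => hz _ ⟨f', rfl⟩⟩, h⟩
  have h1 : delta1 K (delta0 K f) = 0 := by
    refine delta1_eq_zero_iff.mpr fun u v w hT => ?_
    rw [delta0_apply_of_isEdge f ⟨hT.1, mem_faces_of_subset hT.2.2.2 (by grind) ⟨u, by simp⟩⟩,
      delta0_apply_of_isEdge f ⟨hT.2.1, mem_faces_of_subset hT.2.2.2 (by grind) ⟨u, by simp⟩⟩,
      delta0_apply_of_isEdge f ⟨hT.2.2.1, mem_faces_of_subset hT.2.2.2 (by grind) ⟨v, by simp⟩⟩]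
    ring
  rw [h, map_add, h1, zero_add] at hτ
  exact hτ

theorem IsComplexification.conjCochain_mem_harmonic {ip : InnerProductSpace.Core ℂ (Cochain1 K)}
    (hip : IsComplexification ip) {σ : Cochain1 K} (hσ : σ ∈ harmonic ip) :
    conjCochain σ ∈ harmonic ip := by
  refine ⟨delta1_conjCochain hσ.1, fun f => ?_⟩
  have h := hip σ (conjCochain (delta0 K f))
  rw [conjCochain_conjCochain, conjCochain_delta0, hσ.2, map_zero] at h
  exact h

/-- For a real inner product, `⟨σ, τ̄⟩` is its complex bilinear extension, hence symmetric. -/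
theorem IsComplexification.herm_conjCochain_comm {ip : InnerProductSpace.Core ℂ (Cochain1 K)}
    (hip : IsComplexification ip) (σ τ : Cochain1 K) :
    herm ip σ (conjCochain τ) = herm ip τ (conjCochain σ) := by
  have h := hip (conjCochain τ) σ
  rw [conjCochain_conjCochain, conj_herm] at h
  exact h.symm

theorem holomorphic_le_harmonic [Fintype V] (o : SurfaceOrientation K) :
    holomorphic o ip ≤ harmonic ip :=
  Submodule.span_le.mpr fun _ h => h.1

end Herm

/-! ### The period form and the eigencochains of the star operator -/

namespace CanonicalPolygon

variable {V W : Type*} [Fintype V] [DecidableEq V] [Fintype W] [DecidableEq W]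
  {K : AbstractSimplicialComplex V} {o : SurfaceOrientation K} {g : ℕ} [NeZero g]
  {D : AbstractSimplicialComplex W}

/-- The bilinear form `∑ (A_i B_i' - B_i A_i')` in the periods of two cochains. -/
noncomputable def periodForm (P : CanonicalPolygon K o g D) (σ τ : Cochain1 K) : ℂ :=
  ∑ i, (P.periodA σ i * P.periodB τ i - P.periodB σ i * P.periodA τ i)

theorem periodForm_swap (P : CanonicalPolygon K o g D) (σ τ : Cochain1 K) :
    P.periodForm τ σ = - P.periodForm σ τ := by
  rw [periodForm, periodForm, ← Finset.sum_neg_distrib]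
  exact Finset.sum_congr rfl fun i _ => by ring

theorem periodForm_add_left (P : CanonicalPolygon K o g D) (σ σ' τ : Cochain1 K) :
    P.periodForm (σ + σ') τ = P.periodForm σ τ + P.periodForm σ' τ := by
  rw [periodForm, periodForm, periodForm, ← Finset.sum_add_distrib]
  refine Finset.sum_congr rfl fun i _ => ?_
  simp only [periodA, periodB, period_add]
  ring

theorem periodForm_smul_left (P : CanonicalPolygon K o g D) (z : ℂ) (σ τ : Cochain1 K) :
    P.periodForm (z • σ) τ = z * P.periodForm σ τ := by
  rw [periodForm, periodForm, Finset.mul_sum]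
  refine Finset.sum_congr rfl fun i _ => ?_
  simp only [periodA, periodB, period_smul]
  ring

theorem periodForm_conjCochain (P : CanonicalPolygon K o g D) (σ τ : Cochain1 K) :
    P.periodForm (conjCochain σ) (conjCochain τ) = conj (P.periodForm σ τ) := by
  simp only [periodForm, periodA, periodB, period_conjCochain, map_sum, map_sub, map_mul]

/-- If the period form vanishes on a set of cochains, it vanishes on their span. -/
theorem periodForm_eq_zero_of_span (P : CanonicalPolygon K o g D) {S : Set (Cochain1 K)}
    (hS : ∀ σ ∈ S, ∀ τ ∈ S, P.periodForm σ τ = 0) {σ τ : Cochain1 K}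
    (hσ : σ ∈ Submodule.span ℂ S) (hτ : τ ∈ Submodule.span ℂ S) : P.periodForm σ τ = 0 := by
  have left : ∀ ρ, (∀ x ∈ S, P.periodForm x ρ = 0) → ∀ x ∈ Submodule.span ℂ S,
      P.periodForm x ρ = 0 := by
    intro ρ hρ x hx
    induction hx using Submodule.span_induction with
    | mem x h => exact hρ x h
    | zero => simpa using P.periodForm_smul_left 0 0 ρ
    | add x y _ _ hx hy => rw [periodForm_add_left, hx, hy, add_zero]
    | smul z x _ hx => rw [periodForm_smul_left, hx, mul_zero]
  refine left τ (fun x hx => ?_) σ hσ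
  rw [periodForm_swap, left x (fun y hy => hS y hy x hx) τ hτ, neg_zero]

theorem herm_harmonicStar (P : CanonicalPolygon K o g D)
    (ip : InnerProductSpace.Core ℂ (Cochain1 K)) {σ τ : Cochain1 K} (hσ : σ ∈ harmonic ip)
    (hτ : τ ∈ harmonic ip) :
    herm ip (harmonicStar o ip σ) τ = P.periodForm σ (conjCochain τ) := by
  rw [harmonicStar, herm_harmonicPart ip _ hτ, star_spec,
    P.evalFund_cup hσ.1 (delta1_conjCochain hτ.1), periodForm]

/-- Poincaré duality: the star operator is injective on harmonic cochains. -/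
theorem eq_zero_of_harmonicStar_eq_zero (P : CanonicalPolygon K o g D)
    (ip : InnerProductSpace.Core ℂ (Cochain1 K)) {σ : Cochain1 K} (hσ : σ ∈ harmonic ip)
    (h : harmonicStar o ip σ = 0) : σ = 0 := by
  -- These periods turn the period form of `σ` and the conjugate cochain into `∑ (|A_i|² + |B_i|²)`.
  -- Passing to the harmonic part does not change them.
  obtain ⟨τ, hτ, hper⟩ := P.exists_closed_of_periods (fun i => - P.periodB σ i) (P.periodA σ)
  obtain ⟨f, ρ, hρ, rfl⟩ := exists_harmonic_decomposition ip hτ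
  have hA : ∀ i, P.periodA ρ i = - P.periodB σ i := fun i => by
    rw [← (hper i).1, ← zero_add (P.periodA ρ i), ← P.periodA_delta0 f i]
    exact (P.period_add _ _ _ _).symm
  have hB : ∀ i, P.periodB ρ i = P.periodA σ i := fun i => by
    rw [← (hper i).2, ← zero_add (P.periodB ρ i), ← P.periodB_delta0 f i]
    exact (P.period_add _ _ _ _).symm
  have h0 := P.herm_harmonicStar ip hσ hρ
  rw [h, ← zero_smul ℂ (0 : Cochain1 K), herm_smul_left, zero_mul, periodForm] at h0
  have hsum : ∑ i, (Complex.normSq (P.periodA σ i) + Complex.normSq (P.periodB σ i)) = 0 := by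
    have e : ((∑ i, (Complex.normSq (P.periodA σ i) + Complex.normSq (P.periodB σ i)) : ℝ) : ℂ)
        = 0 := by
      rw [h0]
      push_cast
      refine Finset.sum_congr rfl fun i _ => ?_
      have e1 : P.periodA (conjCochain ρ) i = - conj (P.periodB σ i) := by
        rw [periodA, period_conjCochain, ← map_neg, ← hA]; rfl
      have e2 : P.periodB (conjCochain ρ) i = conj (P.periodA σ i) := by
        rw [periodB, period_conjCochain, ← hB]; rfl
      rw [e1, e2, ← Complex.mul_conj, ← Complex.mul_conj]
      ring
    exact_mod_cast e
  rw [Finset.sum_eq_zero_iff_of_nonneg fun i _ =>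
    add_nonneg (Complex.normSq_nonneg _) (Complex.normSq_nonneg _)] at hsum
  have hz : ∀ i, P.periodA σ i = 0 ∧ P.periodB σ i = 0 := fun i => by
    have := (add_eq_zero_iff_of_nonneg (Complex.normSq_nonneg _)
      (Complex.normSq_nonneg _)).mp (hsum i (Finset.mem_univ i))
    exact ⟨Complex.normSq_eq_zero.mp this.1, Complex.normSq_eq_zero.mp this.2⟩
  obtain ⟨F, rfl⟩ := P.exists_eq_delta0_of_period_eq_zero hσ.1 (fun i => (hz i).1)
    fun i => (hz i).2
  exact eq_zero_of_herm_self ip (hσ.2 F)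

theorem mul_herm_eq_periodForm (P : CanonicalPolygon K o g D)
    {ip : InnerProductSpace.Core ℂ (Cochain1 K)} {σ τ : Cochain1 K} (hσ : σ ∈ harmonic ip)
    (hτ : τ ∈ harmonic ip) {z : ℂ} (h : harmonicStar o ip σ = z • σ) :
    z * herm ip σ τ = P.periodForm σ (conjCochain τ) := by
  rw [← P.herm_harmonicStar ip hσ hτ, h, herm_smul_left]

/-- Eigencochains of the star operator for different eigenvalues are orthogonal. -/
theorem herm_eq_zero_of_ne (P : CanonicalPolygon K o g D)
    {ip : InnerProductSpace.Core ℂ (Cochain1 K)} {σ τ : Cochain1 K} (hσ : σ ∈ harmonic ip)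
    (hτ : τ ∈ harmonic ip) {a b : ℝ} (ha : harmonicStar o ip σ = (-Complex.I * a) • σ)
    (hb : harmonicStar o ip τ = (-Complex.I * b) • τ) (hab : a ≠ b) : herm ip σ τ = 0 := by
  have h1 := P.mul_herm_eq_periodForm hσ hτ ha
  have h2 := congrArg conj (P.mul_herm_eq_periodForm hτ hσ hb)
  rw [← P.periodForm_conjCochain, conjCochain_conjCochain, P.periodForm_swap, ← h1, map_mul,
    conj_herm, map_mul, map_neg, Complex.conj_I, Complex.conj_ofReal] at h2
  have h3 : Complex.I * ((a : ℂ) - b) * herm ip σ τ = 0 := by linear_combination -h2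
  refine (mul_eq_zero.mp h3).resolve_left (mul_ne_zero Complex.I_ne_zero ?_)
  rw [← Complex.ofReal_sub]
  exact Complex.ofReal_ne_zero.mpr (sub_ne_zero.mpr hab)

/-- On eigencochains, symmetry of `⟨σ, τ̄⟩` against antisymmetry of the period form gives `(a +
b)⟨σ, τ̄⟩ = 0`. -/
theorem periodForm_eq_zero_of_holomorphic (P : CanonicalPolygon K o g D)
    {ip : InnerProductSpace.Core ℂ (Cochain1 K)} (hip : IsComplexification ip)
    {σ τ : Cochain1 K} (hσ : σ ∈ holomorphic o ip) (hτ : τ ∈ holomorphic o ip) :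
    P.periodForm σ τ = 0 := by
  refine P.periodForm_eq_zero_of_span ?_ hσ hτ
  rintro σ ⟨hσ, a, ha, hσa⟩ τ ⟨hτ, b, hb, hτb⟩
  have h1 := P.mul_herm_eq_periodForm hσ (hip.conjCochain_mem_harmonic hτ) hσa
  have h2 := P.mul_herm_eq_periodForm hτ (hip.conjCochain_mem_harmonic hσ) hτb
  rw [conjCochain_conjCochain] at h1 h2
  rw [P.periodForm_swap, ← hip.herm_conjCochain_comm] at h2
  have h3 : Complex.I * ((a + b : ℝ) : ℂ) * herm ip σ (conjCochain τ) = 0 := by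
    push_cast
    linear_combination -h1 - h2
  rcases mul_eq_zero.mp h3 with h | h
  -- Here nonnegativity is essential: `a + b = 0` forces `a = 0`, and then the period form, being
  -- `-ia⟨σ, τ̄⟩`, vanishes.
  · have hab : a + b = 0 :=
      Complex.ofReal_eq_zero.mp ((mul_eq_zero.mp h).resolve_left Complex.I_ne_zero)
    have ha0 : a = 0 := by linarith
    rw [← h1, ha0]
    simp
  · rw [← h1, h, mul_zero]

/-- Lying in the span does not by itself give `a` a sign. If `a < 0`, orthogonality of eigenspaces
makes `σ` orthogonal to all generators, hence to itself; if `a = 0`, duality gives `σ = 0`. -/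
theorem pos_of_mem_holomorphic (P : CanonicalPolygon K o g D)
    {ip : InnerProductSpace.Core ℂ (Cochain1 K)} {σ : Cochain1 K} (hσ : σ ∈ holomorphic o ip)
    {a : ℝ} (ha : harmonicStar o ip σ = (-Complex.I * a) • σ) (h0 : σ ≠ 0) : 0 < a := by
  have hσ' := holomorphic_le_harmonic ip o hσ
  by_contra hneg
  rcases (not_lt.mp hneg).eq_or_lt with rfl | hlt
  · exact h0 (P.eq_zero_of_harmonicStar_eq_zero ip hσ' (by simpa using ha))
  · have horth : ∀ τ ∈ holomorphic o ip, herm ip σ τ = 0 := by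
      intro τ hτ
      induction hτ using Submodule.span_induction with
      | mem τ h =>
        obtain ⟨hτ, b, hb, hτb⟩ := h
        exact P.herm_eq_zero_of_ne hσ' hτ ha hτb (by linarith : a < b).ne
      | zero => simpa using herm_smul_right ip 0 σ 0
      | add x y _ _ hx hy => rw [herm_add_right, hx, hy, add_zero]
      | smul z x _ hx => rw [herm_smul_right, hx, mul_zero]
    exact h0 (eq_zero_of_herm_self ip (horth σ hσ))

theorem herm_self_eq_periods (P : CanonicalPolygon K o g D)
    {ip : InnerProductSpace.Core ℂ (Cochain1 K)} {σ : Cochain1 K} (hσ : σ ∈ harmonic ip)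
    {a : ℝ} (ha : harmonicStar o ip σ = (-Complex.I * a) • σ) (h0 : 0 < a) :
    herm ip σ σ = Complex.I / a *
      ∑ i, (P.periodA σ i * conj (P.periodB σ i) - P.periodB σ i * conj (P.periodA σ i)) := by
  have h1 := P.mul_herm_eq_periodForm hσ hσ ha
  have h2 : P.periodForm σ (conjCochain σ) =
      ∑ i, (P.periodA σ i * conj (P.periodB σ i) - P.periodB σ i * conj (P.periodA σ i)) := by
    simp only [periodForm, periodA, periodB, period_conjCochain]
  have ha0 : (a : ℂ) ≠ 0 := Complex.ofReal_ne_zero.mpr h0.ne'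
  rw [← h2, ← h1]
  field_simp
  linear_combination herm ip σ σ * Complex.I_sq

end CanonicalPolygon

end CombSurface

theorem mainTheorem9 {V W : Type*} [Fintype V] [DecidableEq V] [Fintype W] [DecidableEq W]
    (K : AbstractSimplicialComplex V) (o : CombSurface.SurfaceOrientation K)
    (g : ℕ) [NeZero g] (D : AbstractSimplicialComplex W)
    (P : CombSurface.CanonicalPolygon K o g D)
    (ip : InnerProductSpace.Core ℂ (CombSurface.Cochain1 K)) :
    (CombSurface.IsComplexification ip →
      ∀ σ ∈ CombSurface.holomorphic o ip, ∀ σ' ∈ CombSurface.holomorphic o ip,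
        (∀ lam : ℝ, CombSurface.harmonicStar o ip σ = (-Complex.I * lam) • σ →
          -Complex.I * lam * CombSurface.herm ip σ (CombSurface.conjCochain σ') =
            ∑ i, (P.periodA σ i * P.periodB σ' i - P.periodB σ i * P.periodA σ' i)) ∧
        ∑ i, (P.periodA σ i * P.periodB σ' i - P.periodB σ i * P.periodA σ' i) = 0) ∧
    ∀ σ ∈ CombSurface.holomorphic o ip, ∀ lam : ℝ,
      CombSurface.harmonicStar o ip σ = (-Complex.I * lam) • σ →
        (σ ≠ 0 → 0 < lam) ∧
        (0 < lam →
          ((CombSurface.hermNorm ip σ ^ 2 : ℝ) : ℂ) = CombSurface.herm ip σ σ ∧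
          CombSurface.herm ip σ σ = Complex.I / lam *
            ∑ i, (P.periodA σ i * conj (P.periodB σ i) - P.periodB σ i * conj (P.periodA σ i)) ∧
          0 ≤ Complex.I / lam *
            ∑ i, (P.periodA σ i * conj (P.periodB σ i) - P.periodB σ i * conj (P.periodA σ i))) := by
  refine ⟨fun hip σ hσ σ' hσ' => ⟨fun lam h => ?_,
    P.periodForm_eq_zero_of_holomorphic hip hσ hσ'⟩, fun σ hσ lam h =>
    ⟨P.pos_of_mem_holomorphic hσ h, fun hlam => ?_⟩⟩
  · have hσ'' := hip.conjCochain_mem_harmonic (CombSurface.holomorphic_le_harmonic ip o hσ')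
    rw [P.mul_herm_eq_periodForm (CombSurface.holomorphic_le_harmonic ip o hσ) hσ'' h,
      CombSurface.conjCochain_conjCochain]
    rfl
  · have e := P.herm_self_eq_periods (CombSurface.holomorphic_le_harmonic ip o hσ) h hlam
    refine ⟨CombSurface.hermNorm_sq ip σ, e, ?_⟩
    rw [← e]
    exact CombSurface.herm_self_nonneg ip σ
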